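/- Let $\mathbf{k}$ be a field. A filtered chain complex $(C_*,\partial,\ell)$ over $\mathbf{k}$ is a $\mathbb{Z}$-graded chain complex of $\mathbf{k}$-vector spaces with a filtration function $\ell$ with values in $\mathbb{R}\cup\{-\infty\}$ such that the sublevel sets $C_k^{\le s}=\{x\in C_k : \ell(x)\le s\}$ are linear subspaces preserved by $\partial$. It is called tame if $\bigoplus_k C_k^{\le s}$ is finite-dimensional for every $s\in\mathbb{R}$ and is $0$ for all sufficiently small $s$. For $s\in\mathbb{R}$ let $\Sigma^s C$ be the same complex with $\ell$ replaced by $\ell+s$, and for $s\ge 0$ let $\eta_s^C:\Sigma^s C\to C$ be the identity on underlying complexes. Let $\mathcal{C}^{t}_0$ be the triangulated category whose objects are the tame filtered chain complexes and whose morphisms are the filtration-preserving chain maps up to filtration-preserving chain homotopy, with exact triangles given by mapping cones. A tame complex $C$ is $s$-acyclic ($s\ge 0$) if its identity map is homotopic to $0$ through a chain homotopy that raises the filtration by at most $s$; let $\mathcal{AC}^{t}_0\subset\mathcal{C}^{t}_0$ be the full triangulated subcategory of the complexes that are $s$-acyclic for some $s\ge 0$. Let $K(\mathcal{C}^{t})$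 and $KA(\mathcal{C}^{t})$ be the Grothendieck groups of the triangulated categories $\mathcal{C}^{t}_0$ and $\mathcal{AC}^{t}_0$, with the products $[X]\cdot[Y]=[X\otimes Y]$, where $\otimes$ is the filtered tensor product (with $\ell(x\otimes y)=\ell(x)+\ell(y)$ on tensors $x\otimes y$, i.e. $(X\otimes Y)^{\le s}$ is spanned by the $X^{\le a}\otimes Y^{\le b}$ with $a+b\le s$). For $r\ge 0$ the acyclic truncation map $$Q_r:K(\mathcal{C}^{t})\to KA(\mathcal{C}^{t})$$ is the group homomorphism with $Q_r([X])=[Q_{r,X}]$, where $\Sigma^rX\xrightarrow{\eta_r^X}X\to Q_{r,X}\to T\Sigma^rX$ is an exact triangle in $\mathcal{C}^{t}_0$, i.e. $Q_{r,X}$ is the mapping cone of $\eta_r^X$ (which is $r$-acyclic). Then for every real number $r>0$ the map $Q_r:K(\mathcal{C}^{t})\to KA(\mathcal{C}^{t})$ is an isomorphism of abelian groups, but it is not multiplicative: there are $x,y\in K(\mathcal{C}^{t})$ with $Q_r(x\cdot y)\ne Q_r(x)\cdot Q_r(y)$. -/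

import Mathlib

open CategoryTheory CategoryTheory.Limits CategoryTheory.Pretriangulated
open scoped TensorProduct DirectSum

universe u v

/-- A vector space over `k` with an increasing filtration `level s` (the subspace usually denoted
`V^{≤ s}`) by subspaces, indexed by the real numbers. -/
structure FiltVect (k : Type u) [Field k] where
  carrier : Type u
  [addCommGroup : AddCommGroup carrier]
  [module : Module k carrier]
  level : ℝ → Submodule k carrier
  mono : Monotone level

namespace FiltVect

attribute [instance] addCommGroup module

variable {k : Type u} [Field k]

/-- A morphism of filtered vector spaces is a linear map that preserves the filtrations. -/
@[ext]
structure Hom (V W : FiltVect k) where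
  lin : V.carrier →ₗ[k] W.carrier
  map_level : ∀ s, ∀ x ∈ V.level s, lin x ∈ W.level s

instance : Category (FiltVect k) where
  Hom := Hom
  id V := ⟨LinearMap.id, fun _ _ h => h⟩
  comp f g := ⟨g.lin ∘ₗ f.lin, fun s _ h => g.map_level s _ (f.map_level s _ h)⟩

@[ext]
lemma hom_ext {V W : FiltVect k} {f g : V ⟶ W} (h : f.lin = g.lin) : f = g := Hom.ext h

@[simp] lemma id_lin (V : FiltVect k) : (𝟙 V : V ⟶ V).lin = LinearMap.id := rfl

@[simp] lemma comp_lin {U V W : FiltVect k} (f : U ⟶ V) (g : V ⟶ W) :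
    (f ≫ g).lin = g.lin ∘ₗ f.lin := rfl

variable (V W : FiltVect k)

instance : Zero (V ⟶ W) := ⟨⟨0, fun s _ _ => (W.level s).zero_mem⟩⟩
instance : Add (V ⟶ W) :=
  ⟨fun f g => ⟨f.lin + g.lin, fun s x h =>
    (W.level s).add_mem (f.map_level s x h) (g.map_level s x h)⟩⟩
instance : Neg (V ⟶ W) :=
  ⟨fun f => ⟨-f.lin, fun s x h => (W.level s).neg_mem (f.map_level s x h)⟩⟩

variable {V W}

@[simp] lemma zero_lin : (0 : V ⟶ W).lin = 0 := rfl
@[simp] lemma add_lin (f g : V ⟶ W) : (f + g).lin = f.lin + g.lin := rfl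
@[simp] lemma neg_lin (f : V ⟶ W) : (-f).lin = -f.lin := rfl

instance : AddCommGroup (V ⟶ W) where
  add_assoc _ _ _ := hom_ext (add_assoc _ _ _)
  zero_add _ := hom_ext (zero_add _)
  add_zero _ := hom_ext (add_zero _)
  add_comm _ _ := hom_ext (add_comm _ _)
  neg_add_cancel _ := hom_ext (neg_add_cancel _)
  nsmul := nsmulRec
  zsmul := zsmulRec

instance : Preadditive (FiltVect k) where
  add_comp _ _ _ _ _ _ := hom_ext (LinearMap.comp_add _ _ _)
  comp_add _ _ _ _ _ _ := hom_ext (LinearMap.add_comp _ _ _)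

/-- In a direct sum of modules with submodules `L j`, the submodule of those families all of whose
components lie in the `L j`. -/
def directSumLevel {J : Type} {M : J → Type u} [∀ j, AddCommGroup (M j)] [∀ j, Module k (M j)]
    (L : ∀ j, Submodule k (M j)) : Submodule k (⨁ j, M j) where
  carrier := {x | ∀ j, x j ∈ L j}
  add_mem' := fun hx hy j => by
    rw [DirectSum.add_apply]
    exact (L j).add_mem (hx j) (hy j)
  zero_mem' := fun j => by
    rw [DirectSum.zero_apply]
    exact (L j).zero_mem
  smul_mem' := fun c x hx j => by
    rw [DirectSum.smul_apply]
    exact (L j).smul_mem c (hx j)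

open Classical in
lemma lof_mem_directSumLevel {J : Type} {M : J → Type u} [∀ j, AddCommGroup (M j)]
    [∀ j, Module k (M j)] (L : ∀ j, Submodule k (M j)) (j : J) (x : M j) (hx : x ∈ L j) :
    DirectSum.lof k J M j x ∈ directSumLevel L := by
  intro i
  by_cases h : j = i
  · subst h
    rw [DirectSum.lof_apply]
    exact hx
  · rw [DirectSum.lof_eq_of, DirectSum.of_eq_of_ne _ _ _ (Ne.symm h)]
    exact (L i).zero_mem

open Classical in
lemma toModule_mem {J : Type} {M : J → Type u} [∀ j, AddCommGroup (M j)]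
    [∀ j, Module k (M j)] (L : ∀ j, Submodule k (M j)) {N : Type u} [AddCommGroup N] [Module k N]
    (P : Submodule k N) (f : ∀ j, M j →ₗ[k] N) (hf : ∀ j, ∀ x ∈ L j, f j x ∈ P)
    (x : ⨁ j, M j) (hx : x ∈ directSumLevel L) : DirectSum.toModule k J N f x ∈ P := by
  rw [DirectSum.toModule, DFinsupp.lsum_apply_apply, DFinsupp.sumAddHom_apply]
  exact Submodule.sum_mem _ (fun j _ => hf j _ (hx j))

/-- The direct sum of filtered vector spaces: its level `s` consists of the families all of whose
components have level `s`. -/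
def directSum {J : Type} (V : J → FiltVect k) : FiltVect k where
  carrier := ⨁ j, (V j).carrier
  level s := directSumLevel (fun j => (V j).level s)
  mono _ _ h _ hx j := (V j).mono h (hx j)

open Classical in
/-- The inclusion of a summand. -/
noncomputable def directSumι {J : Type} (V : J → FiltVect k) (j : J) : V j ⟶ directSum V where
  lin := DirectSum.lof k J (fun j => (V j).carrier) j
  map_level s x hx :=
    lof_mem_directSumLevel (M := fun j => (V j).carrier) (fun j => (V j).level s) j x hx

open Classical in
/-- The morphism from a direct sum given by its components. -/
noncomputable def directSumDesc {J : Type} (V : J → FiltVect k) {W : FiltVect k}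
    (f : ∀ j, V j ⟶ W) : directSum V ⟶ W where
  lin := DirectSum.toModule k J _ (fun j => (f j).lin)
  map_level s x hx := toModule_mem (fun j => (V j).level s) _ _
    (fun j => (f j).map_level s) x hx

lemma directSumι_desc {J : Type} (V : J → FiltVect k) {W : FiltVect k}
    (f : ∀ j, V j ⟶ W) (j : J) : directSumι V j ≫ directSumDesc V f = f j := by
  classical
  apply hom_ext
  apply LinearMap.ext
  intro x
  exact DirectSum.toModule_lof (M := fun j => (V j).carrier) k (φ := fun j => (f j).lin) j x

lemma directSum_hom_ext {J : Type} (V : J → FiltVect k) {W : FiltVect k}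
    (f g : directSum V ⟶ W) (h : ∀ j, directSumι V j ≫ f = directSumι V j ≫ g) : f = g := by
  classical
  apply hom_ext
  exact DirectSum.linearMap_ext k (ψ := f.lin) (ψ' := g.lin) (fun j => by
    have := congrArg Hom.lin (h j)
    rw [comp_lin, comp_lin] at this
    exact this)

/-- The direct sum is a coproduct. -/
noncomputable def directSumIsColimit {J : Type} (V : J → FiltVect k) :
    IsColimit (Cofan.mk (directSum V) (directSumι V)) :=
  Cofan.IsColimit.mk _ (fun s => directSumDesc V s.inj) (fun s j => directSumι_desc V s.inj j)
    (fun s m hm => directSum_hom_ext V _ _ (fun j => by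
      rw [directSumι_desc]; exact hm j))

instance {J : Type} : HasCoproductsOfShape J (FiltVect k) :=
  ⟨fun F =>
    haveI : HasColimit (Discrete.functor (F.obj ∘ Discrete.mk)) :=
      ⟨⟨⟨_, directSumIsColimit (fun j => F.obj ⟨j⟩)⟩⟩⟩
    hasColimit_of_iso Discrete.natIsoFunctor⟩

instance : HasBinaryBiproducts (FiltVect k) :=
  HasBinaryBiproducts.of_hasBinaryCoproducts

instance : HasZeroObject (FiltVect k) :=
  ⟨⟨directSum (fun i : Empty => i.elim),
    (IsZero.iff_id_eq_zero _).2 (directSum_hom_ext _ _ _ (fun j => j.elim))⟩⟩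

/-- The shift functor `Σ^r` on filtered vector spaces: it keeps the underlying vector space and
raises the filtration by `r`, i.e. `(Σ^r V)^{≤ s} = V^{≤ s - r}`. -/
@[simps]
def shiftBy (r : ℝ) : FiltVect k ⥤ FiltVect k where
  obj V :=
    { carrier := V.carrier
      level := fun s => V.level (s - r)
      mono := fun _ _ h => V.mono (sub_le_sub_right h r) }
  map f := ⟨f.lin, fun s => f.map_level (s - r)⟩

instance (r : ℝ) : (shiftBy (k := k) r).Additive where

/-- For `0 ≤ r`, the natural transformation `η_r : Σ^r ⟶ 𝟭` that is the identity on the underlying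
vector spaces. -/
@[simps]
def etaTo (r : ℝ) (h : 0 ≤ r) : shiftBy (k := k) r ⟶ 𝟭 _ where
  app V := ⟨LinearMap.id, fun s _ hx => V.mono (sub_le_self s h) hx⟩

/-- For `0 ≤ r`, the natural transformation `𝟭 ⟶ Σ^{-r}` that is the identity on the underlying
vector spaces. -/
@[simps]
def etaFrom (r : ℝ) (h : 0 ≤ r) : 𝟭 (FiltVect k) ⟶ shiftBy (-r) where
  app V := ⟨LinearMap.id, fun s _ hx => V.mono (by simpa using h) hx⟩

/-- The tensor product of filtered vector spaces: its level `s` is spanned by the `x ⊗ y` with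
`x` of level `a`, `y` of level `b` and `a + b ≤ s`. -/
@[simps]
def tensorObj (V W : FiltVect k) : FiltVect k where
  carrier := V.carrier ⊗[k] W.carrier
  level s := Submodule.span k
    {z | ∃ a b : ℝ, a + b ≤ s ∧ ∃ x ∈ V.level a, ∃ y ∈ W.level b, x ⊗ₜ[k] y = z}
  mono s t h := Submodule.span_mono (by
    rintro _ ⟨a, b, hab, x, hx, y, hy, rfl⟩
    exact ⟨a, b, hab.trans h, x, hx, y, hy, rfl⟩)

/-- The tensor product of morphisms of filtered vector spaces. -/
@[simps]
def tensorMap {V V' W W' : FiltVect k} (f : V ⟶ V') (g : W ⟶ W') :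
    tensorObj V W ⟶ tensorObj V' W' where
  lin := TensorProduct.map f.lin g.lin
  map_level s z hz := by
    refine Submodule.span_le (p := (Submodule.comap (TensorProduct.map f.lin g.lin)
      ((tensorObj V' W').level s))) |>.2 ?_ hz
    rintro _ ⟨a, b, hab, x, hx, y, hy, rfl⟩
    exact Submodule.subset_span ⟨a, b, hab, f.lin x, f.map_level a x hx, g.lin y,
      g.map_level b y hy, rfl⟩

/-- The tensor product of filtered vector spaces as a bifunctor. -/
@[simps]
def tensor : FiltVect k ⥤ FiltVect k ⥤ FiltVect k where
  obj V :=
    { obj := fun W => tensorObj V W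
      map := fun g => tensorMap (𝟙 V) g
      map_id := fun W => hom_ext TensorProduct.map_id
      map_comp := fun f g => hom_ext
        (TensorProduct.ext' fun _ _ => rfl) }
  map f :=
    { app := fun W => tensorMap f (𝟙 W)
      naturality := fun _ _ _ => hom_ext (TensorProduct.ext' fun _ _ => rfl) }
  map_id V := NatTrans.ext (funext fun W => hom_ext TensorProduct.map_id)
  map_comp f g := NatTrans.ext (funext fun W => hom_ext
    (TensorProduct.ext' fun _ _ => rfl))

instance : (tensor (k := k)).Additive where
  map_add {_ _ f g} := NatTrans.ext (funext fun _ => hom_ext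
    (TensorProduct.map_add_left f.lin g.lin LinearMap.id))

instance (V : FiltVect k) : (tensor.obj V).Additive where
  map_add {_ _ f g} := hom_ext (TensorProduct.map_add_right LinearMap.id f.lin g.lin)

end FiltVect

/-- The tensor product of two complexes of filtered vector spaces: in degree `n` it is the direct
sum of the `X p ⊗ Y q` with `p + q = n`, with the differential `d ⊗ 1 + (-1)^p (1 ⊗ d)`. -/
noncomputable abbrev tensorComplex {k : Type u} [Field k] (X Y : CochainComplex (FiltVect k) ℤ) :
    CochainComplex (FiltVect k) ℤ :=
  HomologicalComplex.mapBifunctor X Y FiltVect.tensor (ComplexShape.up ℤ)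

/-- The Grothendieck group of the full subcategory, given by the class `P` of its objects, of a
triangulated category `T`: the abelian group generated by the objects `A` of the subcategory, with a
relation `[B] = [A] + [C]` for each exact triangle `A ⟶ B ⟶ C ⟶ A[1]` whose vertices belong to the
subcategory. -/
def GrothendieckGroup {T : Type u} [Category.{v} T] [HasZeroObject T] [HasShift T ℤ]
    [Preadditive T] [∀ n : ℤ, (shiftFunctor T n).Additive] [Pretriangulated T]
    (P : ObjectProperty T) : Type u :=
  FreeAbelianGroup (Subtype P) ⧸ AddSubgroup.closure
    {x | ∃ A B C : Subtype P, ∃ (f : A.1 ⟶ B.1) (g : B.1 ⟶ C.1) (h : C.1 ⟶ A.1⟦(1 : ℤ)⟧),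
      Triangle.mk f g h ∈ distTriang T ∧
        x = FreeAbelianGroup.of B - FreeAbelianGroup.of A - FreeAbelianGroup.of C}

namespace GrothendieckGroup

section

variable {T : Type u} [Category.{v} T] [HasZeroObject T] [HasShift T ℤ]
  [Preadditive T] [∀ n : ℤ, (shiftFunctor T n).Additive] [Pretriangulated T]
  (P : ObjectProperty T)

instance : AddCommGroup (GrothendieckGroup P) :=
  inferInstanceAs (AddCommGroup (_ ⧸ _))

variable {P}

/-- The class of an object. -/
def mk (A : T) (hA : P A) : GrothendieckGroup P :=
  QuotientAddGroup.mk' _ (FreeAbelianGroup.of ⟨A, hA⟩)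

lemma mk_eq_add {A B C : T} (hA : P A) (hB : P B) (hC : P C) (f : A ⟶ B) (g : B ⟶ C)
    (h : C ⟶ A⟦(1 : ℤ)⟧) (hT : Triangle.mk f g h ∈ distTriang T) :
    mk B hB = mk A hA + mk C hC := by
  rw [← sub_eq_zero, ← sub_sub]
  exact (QuotientAddGroup.eq_zero_iff _).2 (AddSubgroup.subset_closure
    ⟨⟨A, hA⟩, ⟨B, hB⟩, ⟨C, hC⟩, f, g, h, hT, rfl⟩)

/-- Homomorphisms out of the Grothendieck group are given by additive functions. -/
def lift {G : Type*} [AddCommGroup G] (φ : ∀ A : T, P A → G)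
    (hφ : ∀ (A B C : T) (hA : P A) (hB : P B) (hC : P C) (f : A ⟶ B) (g : B ⟶ C)
      (h : C ⟶ A⟦(1 : ℤ)⟧), Triangle.mk f g h ∈ distTriang T → φ B hB = φ A hA + φ C hC) :
    GrothendieckGroup P →+ G :=
  QuotientAddGroup.lift _ (FreeAbelianGroup.lift fun A : Subtype P => φ A.1 A.2) (by
    rw [AddSubgroup.closure_le]
    rintro _ ⟨A, B, C, f, g, h, hT, rfl⟩
    have := hφ A.1 B.1 C.1 A.2 B.2 C.2 f g h hT
    simp [this])

@[simp]
lemma lift_mk {G : Type*} [AddCommGroup G] (φ : ∀ A : T, P A → G) (hφ) (A : T) (hA : P A) :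
    lift φ hφ (mk A hA) = φ A hA :=
  FreeAbelianGroup.lift_apply_of _ _

lemma hom_ext {G : Type*} [AddCommGroup G] {f g : GrothendieckGroup P →+ G}
    (h : ∀ A hA, f (mk A hA) = g (mk A hA)) : f = g := by
  apply QuotientAddGroup.addMonoidHom_ext
  apply FreeAbelianGroup.lift_ext
  rintro ⟨A, hA⟩
  exact h A hA

end

end GrothendieckGroup

/-- Tame filtered complexes. For every `s`, the direct sum over all degrees of the subspaces of
level `s` is finite-dimensional, and it is zero for some `s` (hence for all smaller `s`). The last
two conditions say that the filtration comes from a filtration function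
`ℓ x = min {s | x ∈ level s}` with values in `ℝ ∪ {-∞}`: every element has some level, and the
infimum of the levels of an element is attained. (Differentials raise the degree here, so the
degree `i` part is the part of degree `-i` of a chain complex.) -/
structure CochainComplex.IsTame {k : Type u} [Field k] (X : CochainComplex (FiltVect k) ℤ) :
    Prop where
  finite_degrees : ∀ s, {i : ℤ | (X.X i).level s ≠ ⊥}.Finite
  finiteDimensional : ∀ s i, FiniteDimensional k ((X.X i).level s)
  bounded_below : ∃ s, ∀ i, (X.X i).level s = ⊥
  exhaustive : ∀ i, ∀ x : (X.X i).carrier, ∃ s, x ∈ (X.X i).level s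
  right_continuous : ∀ i s, ∀ x : (X.X i).carrier,
    (∀ t > s, x ∈ (X.X i).level t) → x ∈ (X.X i).level s

section

variable (k : Type u) [Field k]

/-- The homotopy category of complexes of filtered vector spaces: filtration-preserving chain maps
up to filtration-preserving chain homotopies, triangulated by the cone triangles. -/
abbrev FiltHo : Type (u + 1) := HomotopyCategory (FiltVect k) (ComplexShape.up ℤ)

/-- A filtered complex as an object of the homotopy category. -/
noncomputable abbrev ho {k : Type u} [Field k] (X : CochainComplex (FiltVect k) ℤ) : FiltHo k :=
  (HomotopyCategory.quotient _ _).obj X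

/-- The shift functor `Σ^r` on filtered complexes: it raises the filtration by `r`. -/
noncomputable abbrev sigma (r : ℝ) :
    CochainComplex (FiltVect k) ℤ ⥤ CochainComplex (FiltVect k) ℤ :=
  (FiltVect.shiftBy r).mapHomologicalComplex _

/-- For `0 ≤ r`, the natural map `η_r : Σ^r X ⟶ X`, which is the identity on the underlying
complexes. -/
noncomputable def etaMap {k : Type u} [Field k] (r : ℝ) (hr : 0 ≤ r)
    (X : CochainComplex (FiltVect k) ℤ) : (sigma k r).obj X ⟶ X where
  f i := (FiltVect.etaTo r hr).app (X.X i)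
  comm' i j _ := (FiltVect.etaTo r hr).naturality (X.d i j) |>.symm

/-- For `0 ≤ r`, the natural map `X ⟶ Σ^{-r} X`, which is the identity on the underlying
complexes. -/
noncomputable def etaUp {k : Type u} [Field k] (r : ℝ) (hr : 0 ≤ r)
    (X : CochainComplex (FiltVect k) ℤ) : X ⟶ (sigma k (-r)).obj X where
  f i := (FiltVect.etaFrom r hr).app (X.X i)
  comm' i j _ := (FiltVect.etaFrom r hr).naturality (X.d i j) |>.symm

/-- `X` is `r`-acyclic: the image of `𝟙 X` in `hom^r(X, X)` vanishes. Here `hom^r(X, Y)`, the group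
of homotopy classes of chain maps that raise the filtration by at most `r`, is the group of morphisms
`X ⟶ Σ^{-r} Y` in the homotopy category. -/
def CochainComplex.IsAcyclicAt {k : Type u} [Field k] (X : CochainComplex (FiltVect k) ℤ)
    (r : ℝ) (hr : 0 ≤ r) : Prop :=
  (HomotopyCategory.quotient _ _).map (etaUp r hr X) = 0

end

lemma exists_distTriang_of_iso {T : Type u} [Category.{v} T] [HasZeroObject T] [HasShift T ℤ]
    [Preadditive T] [∀ n : ℤ, (shiftFunctor T n).Additive] [Pretriangulated T]
    {D : Triangle T} (hD : D ∈ distTriang T) {X Y Z : T} (e₁ : X ≅ D.obj₁) (e₂ : Y ≅ D.obj₂)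
    (e₃ : Z ≅ D.obj₃) :
    ∃ (f : X ⟶ Y) (g : Y ⟶ Z) (h : Z ⟶ X⟦(1 : ℤ)⟧), Triangle.mk f g h ∈ distTriang T := by
  refine ⟨e₁.hom ≫ D.mor₁ ≫ e₂.inv, e₂.hom ≫ D.mor₂ ≫ e₃.inv,
    e₃.hom ≫ D.mor₃ ≫ (e₁.inv)⟦(1 : ℤ)⟧', ?_⟩
  refine isomorphic_distinguished _ hD _ (Triangle.isoMk _ _ e₁ e₂ e₃ ?_ ?_ ?_)
  · change (e₁.hom ≫ D.mor₁ ≫ e₂.inv) ≫ e₂.hom = e₁.hom ≫ D.mor₁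
    simp
  · change (e₂.hom ≫ D.mor₂ ≫ e₃.inv) ≫ e₃.hom = e₂.hom ≫ D.mor₂
    simp
  · change (e₃.hom ≫ D.mor₃ ≫ (e₁.inv)⟦(1 : ℤ)⟧') ≫ (e₁.hom)⟦(1 : ℤ)⟧' = e₃.hom ≫ D.mor₃
    simp [← Functor.map_comp]

section

variable {C : Type u} [Category.{v} C] [Preadditive C]

/-- Degreewise split short exact sequences of complexes. -/
def IsDegreewiseSplit {X Y Z : CochainComplex C ℤ} (f : X ⟶ Y) (g : Y ⟶ Z) : Prop :=
  f ≫ g = 0 ∧ ∀ n, ∃ (r : Y.X n ⟶ X.X n) (s : Z.X n ⟶ Y.X n),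
    f.f n ≫ r = 𝟙 _ ∧ s ≫ g.f n = 𝟙 _ ∧ r ≫ f.f n + g.f n ≫ s = 𝟙 _

open CochainComplex in
lemma IsDegreewiseSplit.cone [HasBinaryBiproducts C] {X Y Z X' Y' Z' : CochainComplex C ℤ}
    {f : X ⟶ Y} {g : Y ⟶ Z} {f' : X' ⟶ Y'} {g' : Y' ⟶ Z'}
    (h : IsDegreewiseSplit f g) (h' : IsDegreewiseSplit f' g') (a : X ⟶ X') (b : Y ⟶ Y')
    (c : Z ⟶ Z') (w₁ : a ≫ f' = f ≫ b) (w₂ : b ≫ g' = g ≫ c) :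
    IsDegreewiseSplit (mappingCone.map a b f f' w₁) (mappingCone.map b c g g' w₂) := by
  obtain ⟨w, h⟩ := h
  obtain ⟨w', h'⟩ := h'
  choose r s h₁ h₂ h₃ using h
  choose r' s' h₁' h₂' h₃' using h'
  refine ⟨?_, fun n => ?_⟩
  · ext n : 1
    have hw (m : ℤ) : f.f m ≫ g.f m = 0 := by rw [← HomologicalComplex.comp_f, w]; rfl
    have hw' (m : ℤ) : f'.f m ≫ g'.f m = 0 := by rw [← HomologicalComplex.comp_f, w']; rfl
    apply mappingCone.ext_from _ (n + 1) n rfl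
    · simp [mappingCone.map, reassoc_of% hw]
    · simp [mappingCone.map, reassoc_of% hw']
  · refine ⟨(mappingCone.fst b).1.v n (n + 1) rfl ≫ r (n + 1) ≫
          (mappingCone.inl a).v (n + 1) n (by lia) +
        (mappingCone.snd b).v n n (add_zero n) ≫ r' n ≫ (mappingCone.inr a).f n,
      (mappingCone.fst c).1.v n (n + 1) rfl ≫ s (n + 1) ≫
          (mappingCone.inl b).v (n + 1) n (by lia) +
        (mappingCone.snd c).v n n (add_zero n) ≫ s' n ≫ (mappingCone.inr b).f n, ?_, ?_, ?_⟩
    · apply mappingCone.ext_from _ (n + 1) n rfl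
      · simp [mappingCone.map, reassoc_of% h₁]
      · simp [mappingCone.map, reassoc_of% h₁']
    · apply mappingCone.ext_from _ (n + 1) n rfl
      · simp [mappingCone.map, reassoc_of% h₂]
      · simp [mappingCone.map, reassoc_of% h₂']
    · apply mappingCone.ext_from _ (n + 1) n rfl
      · have := congrArg (fun z => z ≫ (mappingCone.inl b).v (n + 1) n (by lia)) (h₃ (n + 1))
        simpa [mappingCone.map] using this
      · have := congrArg (fun z => z ≫ (mappingCone.inr b).f n) (h₃' n)
        simpa [mappingCone.map] using this

end

section

variable {k : Type u} [Field k]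

/-- An operation on complexes that carries the vertices of exact triangles of the homotopy category
to the vertices of exact triangles. -/
def PreservesTriangleVertices
    (F : CochainComplex (FiltVect k) ℤ → CochainComplex (FiltVect k) ℤ) : Prop :=
  ∀ (A B C : FiltHo k) (f : A ⟶ B) (g : B ⟶ C) (h : C ⟶ A⟦(1 : ℤ)⟧),
    Triangle.mk f g h ∈ distTriang (FiltHo k) →
    ∃ (f' : ho (F A.as) ⟶ ho (F B.as)) (g' : ho (F B.as) ⟶ ho (F C.as))
      (h' : ho (F C.as) ⟶ (ho (F A.as))⟦(1 : ℤ)⟧), Triangle.mk f' g' h' ∈ distTriang (FiltHo k)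

lemma preservesTriangleVertices_of_split
    (F : CochainComplex (FiltVect k) ℤ ⥤ CochainComplex (FiltVect k) ℤ)
    (h_iso : ∀ X Y, Nonempty (ho X ≅ ho Y) → Nonempty (ho (F.obj X) ≅ ho (F.obj Y)))
    (h_split : ∀ (X Y Z : CochainComplex (FiltVect k) ℤ) (f : X ⟶ Y) (g : Y ⟶ Z),
      IsDegreewiseSplit f g → IsDegreewiseSplit (F.map f) (F.map g)) :
    PreservesTriangleVertices F.obj := by
  intro A B C f g h hT
  obtain ⟨S, σ, ⟨e⟩⟩ :=
    (HomotopyCategory.distinguished_iff_iso_trianglehOfDegreewiseSplit _).1 hT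
  obtain ⟨w, hσ⟩ := h_split _ _ _ S.f S.g
    ⟨S.zero, fun n => ⟨(σ n).r, (σ n).s, (σ n).f_r, (σ n).s_g, (σ n).id⟩⟩
  choose r s h₁ h₂ h₃ using hσ
  let e₁ : A ≅ ho S.X₁ := Triangle.π₁.mapIso e
  let e₂ : B ≅ ho S.X₂ := Triangle.π₂.mapIso e
  let e₃ : C ≅ ho S.X₃ := Triangle.π₃.mapIso e
  obtain ⟨i₁⟩ := h_iso A.as S.X₁ ⟨e₁⟩
  obtain ⟨i₂⟩ := h_iso B.as S.X₂ ⟨e₂⟩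
  obtain ⟨i₃⟩ := h_iso C.as S.X₃ ⟨e₃⟩
  exact exists_distTriang_of_iso ((HomotopyCategory.distinguished_iff_iso_trianglehOfDegreewiseSplit
    (CochainComplex.trianglehOfDegreewiseSplit (ShortComplex.mk _ _ w)
      (fun n => ⟨r n, s n, h₁ n, h₂ n, h₃ n⟩))).2 ⟨_, _, ⟨Iso.refl _⟩⟩) i₁ i₂ i₃

/-- The cone of `η_r : Σ^r X ⟶ X`. -/
noncomputable abbrev coneEta (r : ℝ) (hr : 0 ≤ r) (X : CochainComplex (FiltVect k) ℤ) :
    CochainComplex (FiltVect k) ℤ :=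
  CochainComplex.mappingCone (etaMap r hr X)

lemma etaMap_naturality (r : ℝ) (hr : 0 ≤ r) {X Y : CochainComplex (FiltVect k) ℤ} (f : X ⟶ Y) :
    etaMap r hr X ≫ f = (sigma k r).map f ≫ etaMap r hr Y := by
  ext i : 1
  exact ((FiltVect.etaTo r hr).naturality (f.f i)).symm

/-- The cone of `η_r` as a functor. -/
noncomputable def coneEtaFunctor (r : ℝ) (hr : 0 ≤ r) :
    CochainComplex (FiltVect k) ℤ ⥤ CochainComplex (FiltVect k) ℤ where
  obj := coneEta r hr
  map f := CochainComplex.mappingCone.map _ _ ((sigma k r).map f) f (etaMap_naturality r hr f)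
  map_id X := by
    simpa using CochainComplex.mappingCone.map_id (etaMap r hr X)
  map_comp f g := by
    simpa using CochainComplex.mappingCone.map_comp _ _ _ _ _ (etaMap_naturality r hr f) _ _
      (etaMap_naturality r hr g)

lemma homotopic_sigma (r : ℝ) {X Y : CochainComplex (FiltVect k) ℤ} (e : ho X ≅ ho Y) :
    ∃ f : X ⟶ Y, (HomotopyCategory.quotient _ _).map f = e.hom ∧
      IsIso ((HomotopyCategory.quotient _ _).map ((sigma k r).map f)) := by
  let E := HomotopyCategory.homotopyEquivOfIso e
  refine ⟨E.hom, HomotopyCategory.quotient_map_out e.hom, ?_⟩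
  exact inferInstanceAs (IsIso (HomotopyCategory.isoOfHomotopyEquiv
    ((FiltVect.shiftBy r).mapHomotopyEquiv E)).hom)

lemma coneEta_iso (r : ℝ) (hr : 0 ≤ r) (X Y : CochainComplex (FiltVect k) ℤ)
    (h : Nonempty (ho X ≅ ho Y)) : Nonempty (ho (coneEta r hr X) ≅ ho (coneEta r hr Y)) := by
  obtain ⟨e⟩ := h
  obtain ⟨f, hf, hf'⟩ := homotopic_sigma r e
  exact ⟨Triangle.π₃.mapIso (isoTriangleOfIso₁₂
    (CochainComplex.mappingCone.triangleh (etaMap r hr X))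
    (CochainComplex.mappingCone.triangleh (etaMap r hr Y))
    (HomotopyCategory.mappingCone_triangleh_distinguished _)
    (HomotopyCategory.mappingCone_triangleh_distinguished _)
    (@asIso _ _ _ _ ((HomotopyCategory.quotient _ _).map ((sigma k r).map f)) hf') e (by
      rw [← hf]
      change (HomotopyCategory.quotient _ _).map (etaMap r hr X) ≫
          (HomotopyCategory.quotient _ _).map f =
        (HomotopyCategory.quotient _ _).map ((sigma k r).map f) ≫
          (HomotopyCategory.quotient _ _).map (etaMap r hr Y)
      rw [← Functor.map_comp, ← Functor.map_comp, etaMap_naturality]))⟩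

lemma sigma_split (r : ℝ) {X Y Z : CochainComplex (FiltVect k) ℤ}
    {f : X ⟶ Y} {g : Y ⟶ Z} (h : IsDegreewiseSplit f g) :
    IsDegreewiseSplit ((sigma k r).map f) ((sigma k r).map g) := by
  obtain ⟨w, h⟩ := h
  refine ⟨by rw [← Functor.map_comp, w, Functor.map_zero], fun n => ?_⟩
  obtain ⟨ρ, σ, h₁, h₂, h₃⟩ := h n
  refine ⟨(FiltVect.shiftBy r).map ρ, (FiltVect.shiftBy r).map σ, ?_, ?_, ?_⟩
  · exact congrArg (FiltVect.shiftBy r).map h₁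
  · exact congrArg (FiltVect.shiftBy r).map h₂
  · exact congrArg (FiltVect.shiftBy r).map h₃

lemma coneEta_split (r : ℝ) (hr : 0 ≤ r) (X Y Z : CochainComplex (FiltVect k) ℤ)
    (f : X ⟶ Y) (g : Y ⟶ Z) (h : IsDegreewiseSplit f g) :
    IsDegreewiseSplit ((coneEtaFunctor r hr).map f) ((coneEtaFunctor r hr).map g) :=
  IsDegreewiseSplit.cone (sigma_split r h) h _ _ _ (etaMap_naturality r hr f)
    (etaMap_naturality r hr g)

lemma coneEta_preserves (r : ℝ) (hr : 0 ≤ r) :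
    PreservesTriangleVertices (k := k) (coneEta r hr) :=
  preservesTriangleVertices_of_split (coneEtaFunctor r hr) (coneEta_iso r hr) (coneEta_split r hr)

end

section

variable {C : Type u} [Category.{v} C] [Preadditive C] (F : C ⥤ C ⥤ C) [F.Additive]
  [∀ X, (F.obj X).Additive]
  [∀ K L : CochainComplex C ℤ, HomologicalComplex.HasMapBifunctor K L F (ComplexShape.up ℤ)]

open HomologicalComplex

/-- The functor `K ↦ F(K, L)` on complexes. -/
noncomputable def bifunctorLeft (L : CochainComplex C ℤ) :
    CochainComplex C ℤ ⥤ CochainComplex C ℤ where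
  obj K := mapBifunctor K L F (ComplexShape.up ℤ)
  map f := mapBifunctorMap f (𝟙 L) F (ComplexShape.up ℤ)
  map_id K := by ext; simp
  map_comp f g := by ext; simp

/-- The functor `L ↦ F(K, L)` on complexes. -/
noncomputable def bifunctorRight (K : CochainComplex C ℤ) :
    CochainComplex C ℤ ⥤ CochainComplex C ℤ where
  obj L := mapBifunctor K L F (ComplexShape.up ℤ)
  map f := mapBifunctorMap (𝟙 K) f F (ComplexShape.up ℤ)
  map_id K := by ext; simp
  map_comp f g := by ext; simp

lemma bifunctorLeft_iso (L : CochainComplex C ℤ) (X Y : CochainComplex C ℤ)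
    (h : Nonempty ((HomotopyCategory.quotient C (ComplexShape.up ℤ)).obj X ≅
      (HomotopyCategory.quotient C (ComplexShape.up ℤ)).obj Y)) :
    Nonempty ((HomotopyCategory.quotient C (ComplexShape.up ℤ)).obj ((bifunctorLeft F L).obj X) ≅
      (HomotopyCategory.quotient C (ComplexShape.up ℤ)).obj ((bifunctorLeft F L).obj Y)) := by
  obtain ⟨e⟩ := h
  let E := HomotopyCategory.homotopyEquivOfIso e
  refine ⟨HomotopyCategory.isoOfHomotopyEquiv ⟨(bifunctorLeft F L).map E.hom,
    (bifunctorLeft F L).map E.inv, ?_, ?_⟩⟩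
  · refine (Homotopy.ofEq ((bifunctorLeft F L).map_comp _ _).symm).trans
      ((mapBifunctorMapHomotopy₁ E.homotopyHomInvId (𝟙 L) F _).trans
      (Homotopy.ofEq ((bifunctorLeft F L).map_id _)))
  · refine (Homotopy.ofEq ((bifunctorLeft F L).map_comp _ _).symm).trans
      ((mapBifunctorMapHomotopy₁ E.homotopyInvHomId (𝟙 L) F _).trans
      (Homotopy.ofEq ((bifunctorLeft F L).map_id _)))

lemma bifunctorRight_iso (L : CochainComplex C ℤ) (X Y : CochainComplex C ℤ)
    (h : Nonempty ((HomotopyCategory.quotient C (ComplexShape.up ℤ)).obj X ≅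
      (HomotopyCategory.quotient C (ComplexShape.up ℤ)).obj Y)) :
    Nonempty ((HomotopyCategory.quotient C (ComplexShape.up ℤ)).obj ((bifunctorRight F L).obj X) ≅
      (HomotopyCategory.quotient C (ComplexShape.up ℤ)).obj ((bifunctorRight F L).obj Y)) := by
  obtain ⟨e⟩ := h
  let E := HomotopyCategory.homotopyEquivOfIso e
  refine ⟨HomotopyCategory.isoOfHomotopyEquiv ⟨(bifunctorRight F L).map E.hom,
    (bifunctorRight F L).map E.inv, ?_, ?_⟩⟩
  · refine (Homotopy.ofEq ((bifunctorRight F L).map_comp _ _).symm).trans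
      ((mapBifunctorMapHomotopy₂ (𝟙 L) E.homotopyHomInvId F _).trans
      (Homotopy.ofEq ((bifunctorRight F L).map_id _)))
  · refine (Homotopy.ofEq ((bifunctorRight F L).map_comp _ _).symm).trans
      ((mapBifunctorMapHomotopy₂ (𝟙 L) E.homotopyInvHomId F _).trans
      (Homotopy.ofEq ((bifunctorRight F L).map_id _)))

lemma bifunctorLeft_split (L : CochainComplex C ℤ) (X Y Z : CochainComplex C ℤ)
    (f : X ⟶ Y) (g : Y ⟶ Z) (h : IsDegreewiseSplit f g) :
    IsDegreewiseSplit (mapBifunctorMap f (𝟙 L) F (ComplexShape.up ℤ))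
      (mapBifunctorMap g (𝟙 L) F (ComplexShape.up ℤ)) := by
  obtain ⟨w, h⟩ := h
  choose r s h₁ h₂ h₃ using h
  have hw (m : ℤ) : f.f m ≫ g.f m = 0 := by rw [← HomologicalComplex.comp_f, w]; rfl
  refine ⟨?_, fun n => ?_⟩
  · ext n : 1
    apply mapBifunctor.hom_ext
    intro i j hij
    have := congrArg (fun z => (F.map z).app (L.X j)) (hw i)
    simp at this
    simp [reassoc_of% this]
  · refine ⟨mapBifunctorDesc (fun i j hij => (F.map (r i)).app (L.X j) ≫
      ιMapBifunctor X L F (ComplexShape.up ℤ) i j n hij),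
      mapBifunctorDesc (fun i j hij => (F.map (s i)).app (L.X j) ≫
      ιMapBifunctor Y L F (ComplexShape.up ℤ) i j n hij), ?_, ?_, ?_⟩
    · apply mapBifunctor.hom_ext
      intro i j hij
      have := congrArg (fun z => (F.map z).app (L.X j)) (h₁ i)
      simp at this
      simp [reassoc_of% this]
    · apply mapBifunctor.hom_ext
      intro i j hij
      have := congrArg (fun z => (F.map z).app (L.X j)) (h₂ i)
      simp at this
      simp [reassoc_of% this]
    · apply mapBifunctor.hom_ext
      intro i j hij
      have := congrArg (fun z => (F.map z).app (L.X j) ≫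
        ιMapBifunctor Y L F (ComplexShape.up ℤ) i j n hij) (h₃ i)
      simp at this
      simpa using this

lemma bifunctorRight_split (L : CochainComplex C ℤ) (X Y Z : CochainComplex C ℤ)
    (f : X ⟶ Y) (g : Y ⟶ Z) (h : IsDegreewiseSplit f g) :
    IsDegreewiseSplit (mapBifunctorMap (𝟙 L) f F (ComplexShape.up ℤ))
      (mapBifunctorMap (𝟙 L) g F (ComplexShape.up ℤ)) := by
  obtain ⟨w, h⟩ := h
  choose r s h₁ h₂ h₃ using h
  have hw (m : ℤ) : f.f m ≫ g.f m = 0 := by rw [← HomologicalComplex.comp_f, w]; rfl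
  refine ⟨?_, fun n => ?_⟩
  · ext n : 1
    apply mapBifunctor.hom_ext
    intro i j hij
    have := congrArg (fun z => (F.obj (L.X i)).map z) (hw j)
    simp at this
    simp [reassoc_of% this]
  · refine ⟨mapBifunctorDesc (fun i j hij => (F.obj (L.X i)).map (r j) ≫
      ιMapBifunctor L X F (ComplexShape.up ℤ) i j n hij),
      mapBifunctorDesc (fun i j hij => (F.obj (L.X i)).map (s j) ≫
      ιMapBifunctor L Y F (ComplexShape.up ℤ) i j n hij), ?_, ?_, ?_⟩
    · apply mapBifunctor.hom_ext
      intro i j hij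
      have := congrArg (fun z => (F.obj (L.X i)).map z) (h₁ j)
      simp at this
      simp [reassoc_of% this]
    · apply mapBifunctor.hom_ext
      intro i j hij
      have := congrArg (fun z => (F.obj (L.X i)).map z) (h₂ j)
      simp at this
      simp [reassoc_of% this]
    · apply mapBifunctor.hom_ext
      intro i j hij
      have := congrArg (fun z => (F.obj (L.X i)).map z ≫
        ιMapBifunctor L Y F (ComplexShape.up ℤ) i j n hij) (h₃ j)
      simp at this
      simpa using this

end

section

variable {C : Type u} [Category.{v} C] [Preadditive C] (F : C ⥤ C ⥤ C) [F.Additive]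
  [∀ X, (F.obj X).Additive]
  [∀ K L : CochainComplex C ℤ, HomologicalComplex.HasMapBifunctor K L F (ComplexShape.up ℤ)]
  (S : C ⥤ C) [S.Additive] (α : 𝟭 C ⟶ S)
  (τ : ∀ V W, (F.obj (S.obj V)).obj W ⟶ S.obj ((F.obj V).obj W))

open HomologicalComplex

lemma homotopic_zero_bifunctor
    (hτ₁ : ∀ {V V' : C} (f : V ⟶ V') (W : C),
      (F.map (S.map f)).app W ≫ τ V' W = τ V W ≫ S.map ((F.map f).app W))
    (hτ₂ : ∀ (V : C) {W W' : C} (g : W ⟶ W'),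
      (F.obj (S.obj V)).map g ≫ τ V W' = τ V W ≫ S.map ((F.obj V).map g))
    (hα : ∀ V W, (F.map (α.app V)).app W ≫ τ V W = α.app _)
    (K L : CochainComplex C ℤ) (a : K ⟶ (S.mapHomologicalComplex _).obj K)
    (ha : ∀ n, a.f n = α.app (K.X n))
    (b : mapBifunctor K L F (ComplexShape.up ℤ) ⟶
      (S.mapHomologicalComplex _).obj (mapBifunctor K L F (ComplexShape.up ℤ)))
    (hb : ∀ n, b.f n = α.app _) (h : Nonempty (Homotopy a 0)) : Nonempty (Homotopy b 0) := by
  obtain ⟨h⟩ := h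
  let ψ : mapBifunctor ((S.mapHomologicalComplex _).obj K) L F (ComplexShape.up ℤ) ⟶
      (S.mapHomologicalComplex _).obj (mapBifunctor K L F (ComplexShape.up ℤ)) :=
    { f := fun n => mapBifunctorDesc (K₁ := (S.mapHomologicalComplex _).obj K) (fun i j hij =>
        τ (K.X i) (L.X j) ≫ S.map (ιMapBifunctor K L F (ComplexShape.up ℤ) i j n hij))
      comm' := fun n n' hn => by
        obtain rfl : n + 1 = n' := hn
        apply mapBifunctor.hom_ext
        intro i j hij
        simp at hij
        subst hij
        have e₁ : (ComplexShape.up ℤ).π (ComplexShape.up ℤ) (ComplexShape.up ℤ) (i + 1, j)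
          = i + j + 1 := by simp; ring
        have e₂ : (ComplexShape.up ℤ).π (ComplexShape.up ℤ) (ComplexShape.up ℤ) (i, j + 1)
          = i + j + 1 := by simp; ring
        have h1 : (ComplexShape.up ℤ).Rel i (i + 1) := rfl
        have h2 : (ComplexShape.up ℤ).Rel j (j + 1) := rfl
        simp [mapBifunctor.d_eq, mapBifunctor.d₁_eq _ _ _ _ h1 _ _ e₁,
          mapBifunctor.d₂_eq _ _ _ _ _ h2 _ e₂]
        have hι := ι_mapBifunctorDesc (K₁ := (S.mapHomologicalComplex _).obj K) (K₂ := L)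
          (F := F) (c := ComplexShape.up ℤ) (fun p q hpq => τ (K.X p) (L.X q) ≫
            S.map (ιMapBifunctor K L F (ComplexShape.up ℤ) p q (i + j) hpq)) i j (by simp)
        refine (Category.assoc _ _ _).symm.trans
          ((congrArg (· ≫ _) hι).trans ((Category.assoc _ _ _).trans ?_))
        have k1 := hτ₁ (K.d i (i + 1)) (L.X j)
        have k2 := hτ₂ (K.X i) (L.d j (j + 1))
        refine Eq.trans (b := τ (K.X i) (L.X j) ≫ S.map (ιMapBifunctor K L F (ComplexShape.up ℤ)
          i j (i + j) (by simp) ≫ (mapBifunctor.D₁ K L F (ComplexShape.up ℤ) (i + j) (i + j + 1) +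
            mapBifunctor.D₂ K L F (ComplexShape.up ℤ) (i + j) (i + j + 1))))
          (congrArg (τ (K.X i) (L.X j) ≫ ·) (by rw [S.map_comp, S.map_add]; rfl)) ?_
        rw [Preadditive.comp_add, mapBifunctor.ι_D₁, mapBifunctor.ι_D₂,
          mapBifunctor.d₁_eq _ _ _ _ h1 _ _ e₁, mapBifunctor.d₂_eq _ _ _ _ _ h2 _ e₂]
        have e₃ : (ComplexShape.up ℤ).ε₁ (ComplexShape.up ℤ) (ComplexShape.up ℤ) (i, j) = 1 := rfl
        have e₄ : (ComplexShape.up ℤ).ε₂ (ComplexShape.up ℤ) (ComplexShape.up ℤ) (i, j) =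
          i.negOnePow := rfl
        rw [e₃, e₄, one_smul, S.map_add, Preadditive.comp_add, Functor.map_units_smul, S.map_comp,
          S.map_comp, Linear.comp_units_smul]
        refine congrArg₂ (· + ·) ?_ (congrArg (i.negOnePow • ·) ?_)
        · rw [← Category.assoc, ← k1, Category.assoc]; rfl
        · rw [← Category.assoc, ← k2, Category.assoc]; rfl }
  have hψ : mapBifunctorMap a (𝟙 L) F (ComplexShape.up ℤ) ≫ ψ = b := by
    ext n : 1
    apply mapBifunctor.hom_ext
    intro i j hij
    have := α.naturality (ιMapBifunctor K L F (ComplexShape.up ℤ) i j n hij)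
    simp [ψ, ha, hb] at this ⊢
    refine Eq.trans ((Category.assoc _ _ _).symm.trans ?_) this.symm
    exact congrArg (· ≫ S.map _) (hα _ _)
  refine ⟨(Homotopy.ofEq hψ.symm).trans (((mapBifunctorMapHomotopy₁ h (𝟙 L) F _).compRight
    ψ).trans (Homotopy.ofEq ?_))⟩
  have : mapBifunctorMap (0 : K ⟶ (S.mapHomologicalComplex _).obj K) (𝟙 L) F
      (ComplexShape.up ℤ) = 0 := by
    ext n : 1
    apply mapBifunctor.hom_ext
    intro i j hij
    simp
  rw [this, zero_comp]

end

section

variable {k : Type u} [Field k]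

namespace FiltVect

/-- The canonical map `Σ^r V ⊗ W ⟶ Σ^r (V ⊗ W)`. -/
def tensorShift (r : ℝ) (V W : FiltVect k) :
    tensorObj ((shiftBy r).obj V) W ⟶ (shiftBy r).obj (tensorObj V W) where
  lin := (LinearMap.id : V.carrier ⊗[k] W.carrier →ₗ[k] V.carrier ⊗[k] W.carrier)
  map_level s z hz := by
    refine Submodule.span_le (p := (show Submodule k (V.carrier ⊗[k] W.carrier) from
      (tensorObj V W).level (s - r))) |>.2 ?_ hz
    rintro _ ⟨a, b, hab, x, hx, y, hy, rfl⟩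
    exact Submodule.subset_span ⟨a - r, b, by linarith, x, hx, y, hy, rfl⟩

end FiltVect

lemma isAcyclicAt_iff (X : CochainComplex (FiltVect k) ℤ) (r : ℝ) (hr : 0 ≤ r) :
    X.IsAcyclicAt r hr ↔ Nonempty (Homotopy (etaUp r hr X) 0) :=
  HomotopyCategory.quotient_map_eq_zero_iff _

lemma CochainComplex.IsAcyclicAt.tensor {X : CochainComplex (FiltVect k) ℤ} {r : ℝ} {hr : 0 ≤ r}
    (h : X.IsAcyclicAt r hr) (Y : CochainComplex (FiltVect k) ℤ) :
    (tensorComplex X Y).IsAcyclicAt r hr := by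
  rw [isAcyclicAt_iff] at h ⊢
  exact homotopic_zero_bifunctor FiltVect.tensor (FiltVect.shiftBy (-r)) (FiltVect.etaFrom r hr)
    (FiltVect.tensorShift (-r))
    (fun f W => FiltVect.hom_ext (TensorProduct.ext' fun _ _ => rfl))
    (fun V _ _ g => FiltVect.hom_ext (TensorProduct.ext' fun _ _ => rfl))
    (fun V W => FiltVect.hom_ext (TensorProduct.ext' fun _ _ => rfl))
    X Y (etaUp r hr X) (fun _ => rfl) _ (fun _ => rfl) h

end

lemma aux_cone {C : Type u} [Category.{v} C] [Preadditive C] (T : C ⥤ C) [T.Additive]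
    {A B D E A' B' : C} (inr : A ⟶ B) (αA : A ⟶ T.obj A) (αB : B ⟶ T.obj B)
    (γA : A ⟶ T.obj A') (inl : A' ⟶ D) (d : D ⟶ B) (dA : A ⟶ E) (γE : E ⟶ T.obj B')
    (inl' : B' ⟶ B) (εA : A' ⟶ A) (dA' : A' ⟶ B')
    (h : inr ≫ αB = αA ≫ T.map inr)
    (h' : inl ≫ d = εA ≫ inr - dA' ≫ inl')
    (h₃ : dA ≫ γE = γA ≫ T.map dA') (h₄ : γA ≫ T.map εA = αA) :
    inr ≫ αB = (γA ≫ T.map inl) ≫ T.map d + dA ≫ γE ≫ T.map inl' := by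
  rw [← Category.assoc dA, h₃, Category.assoc, Category.assoc, ← T.map_comp, h',
      ← T.map_comp, ← Preadditive.comp_add, ← T.map_add, sub_add_cancel, h, ← h₄, T.map_comp,
      Category.assoc]

section

variable {C : Type u} [Category.{v} C] [Preadditive C] [HasBinaryBiproducts C]
  (S T : C ⥤ C) [S.Additive] [T.Additive] (ε : S ⟶ 𝟭 C) (α : 𝟭 C ⟶ T)
  (γ : ∀ V, V ⟶ T.obj (S.obj V))

open CochainComplex HomologicalComplex

lemma homotopic_zero_cone
    (hγ : ∀ {V W : C} (f : V ⟶ W), f ≫ γ W = γ V ≫ T.map (S.map f))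
    (h₁ : ∀ V, γ V ≫ T.map (ε.app V) = α.app V)
    (h₂ : ∀ V, ε.app V ≫ γ V = α.app (S.obj V))
    (K : CochainComplex C ℤ) (e : (S.mapHomologicalComplex _).obj K ⟶ K)
    (he : ∀ n, e.f n = ε.app (K.X n))
    (b : mappingCone e ⟶ (T.mapHomologicalComplex _).obj (mappingCone e))
    (hb : ∀ n, b.f n = α.app _) : Nonempty (Homotopy b 0) := by
  refine ⟨mappingCone.descHomotopy e _ _ 0
    (HomComplex.Cochain.mk fun p q hpq =>
      γ (K.X p) ≫ T.map ((mappingCone.inl e).v p q hpq)) ?_ ?_⟩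
  · ext p q hpq
    have h := α.naturality ((mappingCone.inl e).v p q hpq)
    have h' := congrArg (· ≫ T.map ((mappingCone.inl e).v p q hpq)) (h₂ (K.X p))
    simp [hb, he]
    exact h.trans (h'.symm.trans (Category.assoc _ _ _))
  · ext p
    have h := α.naturality ((mappingCone.inr e).f p)
    have h' := mappingCone.inl_v_d e p (p - 1) (p + 1) (by lia) (by lia)
    simp [hb, HomComplex.δ_v (-1) 0 (by lia) _ p p (by lia) (p-1) (p+1) (by lia) (by lia)]
    have h₃ := hγ (K.d p (p + 1))
    have h₄ := h₁ (K.X p)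
    rw [he] at h'
    exact aux_cone T _ _ _ _ _ _ _ _ _ _ _ h h' h₃ h₄

end

section

variable {k : Type u} [Field k]

/-- The identification of `V` with `Σ^{-r} Σ^r V`. -/
def FiltVect.toShiftShift (r : ℝ) (V : FiltVect k) :
    V ⟶ (FiltVect.shiftBy (-r)).obj ((FiltVect.shiftBy r).obj V) where
  lin := (LinearMap.id : V.carrier →ₗ[k] V.carrier)
  map_level s x hx := by
    change x ∈ V.level (s - -r - r)
    simpa using hx

lemma coneEta_isAcyclicAt (r : ℝ) (hr : 0 ≤ r) (X : CochainComplex (FiltVect k) ℤ) :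
    (coneEta r hr X).IsAcyclicAt r hr := by
  rw [isAcyclicAt_iff]
  exact homotopic_zero_cone (FiltVect.shiftBy r) (FiltVect.shiftBy (-r)) (FiltVect.etaTo r hr)
    (FiltVect.etaFrom r hr) (FiltVect.toShiftShift r) (fun _ => rfl) (fun _ => rfl)
    (fun _ => rfl) X (etaMap r hr X) (fun _ => rfl) _ (fun _ => rfl)

end

namespace FiltVect

variable {k : Type u} [Field k]

/-- The conditions that tameness imposes on a single filtered vector space. -/
structure Good (V : FiltVect k) : Prop where
  finiteDimensional : ∀ s, FiniteDimensional k (V.level s)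
  exhaustive : ∀ x : V.carrier, ∃ s, x ∈ V.level s
  right_continuous : ∀ s, ∀ x : V.carrier, (∀ t > s, x ∈ V.level t) → x ∈ V.level s

lemma exists_level_ne_bot_of_family {V : FiltVect k} {J : Type} {A : J → FiltVect k}
    (p : ∀ j, V ⟶ A j) (hp : ∀ x, (∀ j, (p j).lin x = 0) → x = 0) {s : ℝ}
    (h : V.level s ≠ ⊥) : ∃ j, (A j).level s ≠ ⊥ := by
  obtain ⟨x, hx, hx0⟩ := Submodule.exists_mem_ne_zero_of_ne_bot h
  by_contra! hA
  refine hx0 (hp x fun j => ?_)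
  have := (p j).map_level s x hx
  rw [hA j] at this
  exact (Submodule.mem_bot k).1 this

lemma Good.of_family {V : FiltVect k} {J : Type} {A : J → FiltVect k} (p : ∀ j, V ⟶ A j)
    (hp : ∀ x, (∀ j, (p j).lin x = 0) → x = 0)
    (hl : ∀ s x, (∀ j, (p j).lin x ∈ (A j).level s) → x ∈ V.level s)
    (hf : ∀ x, {j | (p j).lin x ≠ 0}.Finite) (hA : ∀ j, (A j).Good)
    (hs : ∀ s, {j | (A j).level s ≠ ⊥}.Finite) : V.Good where
  finiteDimensional s := by
    have := fun j => (hA j).finiteDimensional s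
    have := (hs s).to_subtype
    have := Fintype.ofFinite {j | (A j).level s ≠ ⊥}
    let φ : V.level s →ₗ[k] (∀ j : {j | (A j).level s ≠ ⊥}, (A j.1).level s) :=
      LinearMap.pi fun j => (p j.1).lin.restrict ((p j.1).map_level s)
    refine FiniteDimensional.of_injective φ ((injective_iff_map_eq_zero φ).2 ?_)
    rintro ⟨x, hx⟩ h
    refine Subtype.ext (hp x fun j => ?_)
    by_cases hj : (A j).level s = ⊥
    · have := (p j).map_level s x hx
      rw [hj] at this
      exact (Submodule.mem_bot k).1 this
    · exact congrArg Subtype.val (congrFun h ⟨j, hj⟩)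
  exhaustive x := by
    choose f hf' using fun j => (hA j).exhaustive ((p j).lin x)
    obtain ⟨M, hM⟩ := ((hf x).image f).bddAbove
    refine ⟨M, hl M x fun j => ?_⟩
    by_cases hj : (p j).lin x = 0
    · rw [hj]; exact Submodule.zero_mem _
    · exact (A j).mono (hM ⟨j, hj, rfl⟩) (hf' j)
  right_continuous s x h := hl s x fun j =>
    (hA j).right_continuous s _ fun t ht => (p j).map_level t x (h t ht)

lemma Good.exists_jumps {V : FiltVect k} (hV : V.Good) {s₀ : ℝ} (h₀ : V.level s₀ = ⊥) (M : ℝ) :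
    ∃ J : Finset ℝ, ∀ a ≤ M, V.level a = ⊥ ∨ ∃ j ∈ J, j ≤ a ∧ V.level a ≤ V.level j := by
  classical
  have := hV.finiteDimensional
  let j (d : ℕ) : ℝ := sInf {b | d ≤ Module.finrank k (V.level b)}
  refine ⟨(Finset.range (Module.finrank k (V.level M) + 1)).image j, fun a ha => ?_⟩
  by_cases h : V.level a = ⊥
  · exact Or.inl h
  have hbdd : BddBelow {b | Module.finrank k (V.level a) ≤ Module.finrank k (V.level b)} := by
    refine ⟨s₀, fun b hb => ?_⟩
    by_contra! hlt
    have hb0 : V.level b = ⊥ := le_bot_iff.1 (h₀ ▸ V.mono hlt.le)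
    have hb' : Module.finrank k (V.level a) ≤ Module.finrank k (V.level b) := hb
    rw [hb0, finrank_bot, Nat.le_zero] at hb'
    exact h (Submodule.finrank_eq_zero.1 hb')
  refine Or.inr ⟨j (Module.finrank k (V.level a)), Finset.mem_image_of_mem _ ?_,
    csInf_le hbdd (le_refl (Module.finrank k (V.level a))), fun x hx => ?_⟩
  · rw [Finset.mem_range, Nat.lt_succ_iff]
    exact Submodule.finrank_mono (V.mono ha)
  · refine hV.right_continuous _ x fun t ht => ?_
    obtain ⟨b, hb, hbt⟩ := exists_lt_of_csInf_lt ⟨a, le_refl (Module.finrank k (V.level a))⟩ ht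
    refine V.mono hbt.le ?_
    rcases le_total a b with hab | hab
    · exact V.mono hab hx
    · rwa [Submodule.eq_of_le_of_finrank_le (V.mono hab) hb]

lemma tensor_generator {V W : FiltVect k} {s s₀ t₀ : ℝ} (hs₀ : V.level s₀ = ⊥)
    (ht₀ : W.level t₀ = ⊥) {a b : ℝ} (hab : a + b ≤ s) {x : V.carrier} (hx : x ∈ V.level a)
    {y : W.carrier} (hy : y ∈ W.level b) :
    x ⊗ₜ[k] y = 0 ∨ V.level a ≠ ⊥ ∧ W.level b ≠ ⊥ ∧ a ≤ s - t₀ ∧ b ≤ s - s₀ := by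
  by_cases hV : V.level a = ⊥
  · rw [hV, Submodule.mem_bot] at hx
    simp [hx]
  by_cases hW : W.level b = ⊥
  · rw [hW, Submodule.mem_bot] at hy
    simp [hy]
  refine Or.inr ⟨hV, hW, ?_, ?_⟩
  · by_contra! h
    exact hW (le_bot_iff.1 (ht₀ ▸ W.mono (by linarith)))
  · by_contra! h
    exact hV (le_bot_iff.1 (hs₀ ▸ V.mono (by linarith)))

lemma tensor_level_ne_bot {V W : FiltVect k} {s s₀ t₀ : ℝ} (hs₀ : V.level s₀ = ⊥)
    (ht₀ : W.level t₀ = ⊥) (h : (tensorObj V W).level s ≠ ⊥) :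
    V.level (s - t₀) ≠ ⊥ ∧ W.level (s - s₀) ≠ ⊥ := by
  by_contra hc
  refine h (le_bot_iff.1 (Submodule.span_le.2 ?_))
  rintro _ ⟨a, b, hab, x, hx, y, hy, rfl⟩
  rcases tensor_generator hs₀ ht₀ hab hx hy with h0 | ⟨hV, hW, ha, hb⟩
  · exact h0
  · exact absurd ⟨fun h' => hV (le_bot_iff.1 (h' ▸ V.mono ha)),
      fun h' => hW (le_bot_iff.1 (h' ▸ W.mono hb))⟩ hc

lemma tensor_good {V W : FiltVect k} (hV : V.Good) (hW : W.Good) {s₀ t₀ : ℝ}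
    (hs₀ : V.level s₀ = ⊥) (ht₀ : W.level t₀ = ⊥) : (tensorObj V W).Good where
  finiteDimensional s := by
    have := hV.finiteDimensional (s - t₀)
    have := hW.finiteDimensional (s - s₀)
    have hfd : FiniteDimensional k (LinearMap.range
        (TensorProduct.mapIncl (V.level (s - t₀)) (W.level (s - s₀)))) := inferInstance
    refine @Submodule.finiteDimensional_of_le k (V.carrier ⊗[k] W.carrier) _ _ _ _
      (LinearMap.range (TensorProduct.mapIncl (V.level (s - t₀)) (W.level (s - s₀)))) hfd
      (Submodule.span_le.2 ?_)
    rintro _ ⟨a, b, hab, x, hx, y, hy, rfl⟩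
    rcases tensor_generator hs₀ ht₀ hab hx hy with h0 | ⟨-, -, ha, hb⟩
    · rw [h0]; exact Submodule.zero_mem _
    · exact ⟨⟨x, V.mono ha hx⟩ ⊗ₜ ⟨y, W.mono hb hy⟩, rfl⟩
  exhaustive z := by
    induction z using TensorProduct.induction_on with
    | zero => exact ⟨0, Submodule.zero_mem _⟩
    | tmul x y =>
      obtain ⟨a, ha⟩ := hV.exhaustive x
      obtain ⟨b, hb⟩ := hW.exhaustive y
      exact ⟨a + b, Submodule.subset_span (R := k) (M := V.carrier ⊗[k] W.carrier) ⟨a, b, le_rfl, x, ha, y, hb, rfl⟩⟩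
    | add z w hz hw =>
      obtain ⟨a, ha⟩ := hz
      obtain ⟨b, hb⟩ := hw
      exact ⟨max a b, Submodule.add_mem _ ((tensorObj V W).mono (le_max_left a b) ha)
        ((tensorObj V W).mono (le_max_right a b) hb)⟩
  right_continuous s z hz := by
    classical
    obtain ⟨J, hJ⟩ := hV.exists_jumps hs₀ (s + 1 - t₀)
    obtain ⟨L, hL⟩ := hW.exists_jumps ht₀ (s + 1 - s₀)
    have hev : ∀ᶠ t in nhdsWithin s (Set.Ioi s), ∀ i ∈ J ×ˢ L, s < i.1 + i.2 → t < i.1 + i.2 := by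
      rw [Filter.eventually_all_finset]
      intro i _
      by_cases hi : s < i.1 + i.2
      · exact nhdsWithin_le_nhds ((Filter.mem_of_superset (Iio_mem_nhds hi) fun _ h _ => h))
      · exact Filter.Eventually.of_forall fun _ h => absurd h hi
    obtain ⟨t, ht, hst, ht1⟩ := (hev.and (Ioc_mem_nhdsGT (lt_add_one s))).exists
    refine Submodule.span_le (p := (show Submodule k (V.carrier ⊗[k] W.carrier) from
      (tensorObj V W).level s)) |>.2 ?_ (hz t hst)
    rintro _ ⟨a, b, hab, x, hx, y, hy, rfl⟩
    rcases tensor_generator hs₀ ht₀ (hab.trans ht1) hx hy with h0 | ⟨hVa, hWb, ha, hb⟩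
    · exact (congrArg (· ∈ (tensorObj V W).level s) h0).mpr (Submodule.zero_mem _)
    obtain ⟨j, hj, hja, hxj⟩ := (hJ a ha).resolve_left hVa
    obtain ⟨l, hl, hlb, hyl⟩ := (hL b hb).resolve_left hWb
    refine Submodule.subset_span ⟨j, l, ?_, x, hxj hx, y, hyl hy, rfl⟩
    by_contra! hc
    have := ht (j, l) (Finset.mk_mem_product hj hl) hc
    simp only at this
    linarith

end FiltVect

section

variable {k : Type u} [Field k]

lemma CochainComplex.IsTame.good {X : CochainComplex (FiltVect k) ℤ} (h : X.IsTame) (i : ℤ) :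
    (X.X i).Good :=
  ⟨fun s => h.finiteDimensional s i, h.exhaustive i, h.right_continuous i⟩

lemma FiltVect.Good.shiftBy {V : FiltVect k} (h : V.Good) (r : ℝ) :
    ((FiltVect.shiftBy r).obj V).Good where
  finiteDimensional s := h.finiteDimensional (s - r)
  exhaustive x := by
    obtain ⟨s, hs⟩ := h.exhaustive x
    refine ⟨s + r, ?_⟩
    change x ∈ V.level (s + r - r)
    rwa [add_sub_cancel_right]
  right_continuous s x hx := h.right_continuous (s - r) x fun t ht => by
    have := hx (t + r) (by linarith)
    change x ∈ V.level (t + r - r) at this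
    rwa [add_sub_cancel_right] at this

open CochainComplex in
lemma coneEta_isTame (r : ℝ) (hr : 0 ≤ r) {X : CochainComplex (FiltVect k) ℤ} (h : X.IsTame) :
    (coneEta r hr X).IsTame := by
  let A (n : ℤ) (b : Bool) : FiltVect k :=
    if b then (FiltVect.shiftBy r).obj (X.X (n + 1)) else X.X n
  let p (n : ℤ) : ∀ b : Bool, (coneEta r hr X).X n ⟶ A n b
    | true => (mappingCone.fst (etaMap r hr X)).1.v n (n + 1) rfl
    | false => (mappingCone.snd (etaMap r hr X)).v n n (add_zero n)
  let i₁ (n : ℤ) : A n true ⟶ (coneEta r hr X).X n :=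
    (mappingCone.inl (etaMap r hr X)).v (n + 1) n (by lia)
  let i₂ (n : ℤ) : A n false ⟶ (coneEta r hr X).X n := (mappingCone.inr (etaMap r hr X)).f n
  have hid (n : ℤ) (x : ((coneEta r hr X).X n).carrier) :
      x = (i₁ n).lin ((p n true).lin x) + (i₂ n).lin ((p n false).lin x) := by
    have := mappingCone.id_X (etaMap r hr X) n (n + 1) rfl
    exact congrArg (fun f => FiltVect.Hom.lin f x) this.symm
  have hp (n : ℤ) (x) (hx : ∀ b, (p n b).lin x = 0) : x = 0 := by
    refine (hid n x).trans ((congrArg₂ (· + ·) ?_ ?_).trans (add_zero 0))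
    · exact (congrArg (i₁ n).lin (hx true)).trans (map_zero _)
    · exact (congrArg (i₂ n).lin (hx false)).trans (map_zero _)
  have hs (n : ℤ) (s : ℝ) (hn : ((coneEta r hr X).X n).level s ≠ ⊥) :
      (X.X (n + 1)).level (s - r) ≠ ⊥ ∨ (X.X n).level s ≠ ⊥ := by
    obtain ⟨b, hb⟩ := FiltVect.exists_level_ne_bot_of_family (p n) (hp n) hn
    cases b
    · exact Or.inr hb
    · exact Or.inl hb
  have hg (n : ℤ) : ((coneEta r hr X).X n).Good := by
    refine FiltVect.Good.of_family (p n) (hp n) (fun s x hx => ?_) (fun x => Set.toFinite _)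
      (fun b => ?_) (fun s => Set.toFinite _)
    · rw [hid n x]
      exact Submodule.add_mem _ (FiltVect.Hom.map_level _ _ _ (hx true))
        (FiltVect.Hom.map_level _ _ _ (hx false))
    · cases b
      · exact h.good n
      · exact (h.good (n + 1)).shiftBy r
  refine ⟨fun s => ?_, fun s n => (hg n).finiteDimensional s, ?_, fun n => (hg n).exhaustive,
    fun n => (hg n).right_continuous⟩
  · refine (((h.finite_degrees (s - r)).preimage (add_left_injective (1 : ℤ)).injOn).union
      (h.finite_degrees s)).subset fun n hn => hs n s hn
  · obtain ⟨s, h0⟩ := h.bounded_below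
    refine ⟨s, fun n => ?_⟩
    by_contra hn
    rcases hs n s hn with h1 | h1
    · exact h1 (le_bot_iff.1 (h0 (n + 1) ▸ (X.X (n + 1)).mono (by linarith)))
    · exact h1 (h0 n)

/-- The projection from a direct sum to a summand. -/
def FiltVect.directSumπ {J : Type} (V : J → FiltVect k) (j : J) : directSum V ⟶ V j where
  lin := DirectSum.component k J (fun j => (V j).carrier) j
  map_level _ _ hx := hx j

open HomologicalComplex in
lemma tensorComplex_isTame {X Y : CochainComplex (FiltVect k) ℤ} (hX : X.IsTame) (hY : Y.IsTame) :
    (tensorComplex X Y).IsTame := by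
  classical
  obtain ⟨s₀, hs₀⟩ := hX.bounded_below
  obtain ⟨t₀, ht₀⟩ := hY.bounded_below
  let J (n : ℤ) := {i : ℤ × ℤ // (ComplexShape.up ℤ).π (ComplexShape.up ℤ) (ComplexShape.up ℤ) i = n}
  let A (n : ℤ) (i : J n) : FiltVect k := FiltVect.tensorObj (X.X i.1.1) (Y.X i.1.2)
  let φ (n : ℤ) : (tensorComplex X Y).X n ⟶ FiltVect.directSum (A n) :=
    mapBifunctorDesc fun i j hij => FiltVect.directSumι (A n) ⟨(i, j), hij⟩
  let ψ (n : ℤ) : FiltVect.directSum (A n) ⟶ (tensorComplex X Y).X n :=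
    FiltVect.directSumDesc (A n) fun i =>
      ιMapBifunctor X Y FiltVect.tensor (ComplexShape.up ℤ) i.1.1 i.1.2 n i.2
  have hφψ (n : ℤ) : φ n ≫ ψ n = 𝟙 _ := by
    apply mapBifunctor.hom_ext
    intro i j hij
    refine (Category.assoc _ _ _).symm.trans ((congrArg (· ≫ ψ n)
      (ι_mapBifunctorDesc (K₁ := X) (K₂ := Y) (F := FiltVect.tensor) (c := ComplexShape.up ℤ)
        (fun i j hij => FiltVect.directSumι (A n) ⟨(i, j), hij⟩) i j hij)).trans ?_)
    exact (FiltVect.directSumι_desc (A n) _ ⟨(i, j), hij⟩).trans (Category.comp_id _).symm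
  have hid (n : ℤ) (x) : (ψ n).lin ((φ n).lin x) = x :=
    congrArg (fun f => FiltVect.Hom.lin f x) (hφψ n)
  let p (n : ℤ) (i : J n) : (tensorComplex X Y).X n ⟶ A n i := φ n ≫ FiltVect.directSumπ (A n) i
  have hp (n : ℤ) (x) (hx : ∀ b, (p n b).lin x = 0) : x = 0 := by
    have : (φ n).lin x = 0 := DFinsupp.ext hx
    rw [← hid n x, this, map_zero]
  have hA (n : ℤ) (i : J n) (s : ℝ) (hi : (A n i).level s ≠ ⊥) :
      i.1 ∈ {p | (X.X p).level (s - t₀) ≠ ⊥} ×ˢ {q | (Y.X q).level (s - s₀) ≠ ⊥} :=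
    FiltVect.tensor_level_ne_bot (hs₀ _) (ht₀ _) hi
  have hfin (s : ℝ) :
      ({p | (X.X p).level (s - t₀) ≠ ⊥} ×ˢ {q | (Y.X q).level (s - s₀) ≠ ⊥}).Finite :=
    (hX.finite_degrees _).prod (hY.finite_degrees _)
  have hg (n : ℤ) : ((tensorComplex X Y).X n).Good := by
    refine FiltVect.Good.of_family (p n) (hp n) (fun s x hx => ?_) (fun x => ?_)
      (fun i => FiltVect.tensor_good (hX.good _) (hY.good _) (hs₀ _) (ht₀ _))
      (fun s => ((hfin s).preimage Subtype.val_injective.injOn).subset fun i hi => hA n i s hi)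
    · rw [← hid n x]
      exact (ψ n).map_level s _ hx
    · exact DFinsupp.finite_support ((φ n).lin x)
  refine ⟨fun s => ?_, fun s n => (hg n).finiteDimensional s, ?_, fun n => (hg n).exhaustive,
    fun n => (hg n).right_continuous⟩
  · refine ((hfin s).image fun i => (ComplexShape.up ℤ).π (ComplexShape.up ℤ)
      (ComplexShape.up ℤ) i).subset fun n hn => ?_
    obtain ⟨i, hi⟩ := FiltVect.exists_level_ne_bot_of_family (p n) (hp n) hn
    exact ⟨i.1, hA n i s hi, i.2⟩
  · refine ⟨s₀ + t₀, fun n => ?_⟩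
    by_contra hn
    obtain ⟨i, hi⟩ := FiltVect.exists_level_ne_bot_of_family (p n) (hp n) hn
    refine (hA n i _ hi).1 ?_
    rw [add_sub_cancel_right]
    exact hs₀ _

end

section

variable {k : Type u} [Field k]

lemma tensorComplex_preserves_left (Y : CochainComplex (FiltVect k) ℤ) :
    PreservesTriangleVertices (k := k) (fun X => tensorComplex X Y) :=
  preservesTriangleVertices_of_split (bifunctorLeft FiltVect.tensor Y)
    (bifunctorLeft_iso FiltVect.tensor Y) (bifunctorLeft_split FiltVect.tensor Y)

lemma tensorComplex_preserves_right (X : CochainComplex (FiltVect k) ℤ) :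
    PreservesTriangleVertices (k := k) (fun Y => tensorComplex X Y) :=
  preservesTriangleVertices_of_split (bifunctorRight FiltVect.tensor X)
    (bifunctorRight_iso FiltVect.tensor X) (bifunctorRight_split FiltVect.tensor X)

variable (k) in
/-- The objects of the category `C^t_0`: the tame complexes, with their filtered chain maps up to
filtered chain homotopy. -/
def tame : ObjectProperty (FiltHo k) := fun A => CochainComplex.IsTame A.as

variable (k) in
/-- The objects of `AC^t_0`: the tame complexes that are `r`-acyclic for some `r ≥ 0`. -/
def tameAcyclic : ObjectProperty (FiltHo k) :=
  fun A => CochainComplex.IsTame A.as ∧ ∃ (r : ℝ) (hr : 0 ≤ r), CochainComplex.IsAcyclicAt A.as r hr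

lemma tame_tensorComplex (X Y : CochainComplex (FiltVect k) ℤ) (hX : tame k (ho X))
    (hY : tame k (ho Y)) : tame k (ho (tensorComplex X Y)) :=
  tensorComplex_isTame (X := X) (Y := Y) hX hY

lemma tameAcyclic_tensorComplex (X Y : CochainComplex (FiltVect k) ℤ)
    (hX : tameAcyclic k (ho X)) (hY : tameAcyclic k (ho Y)) :
    tameAcyclic k (ho (tensorComplex X Y)) := by
  obtain ⟨r, hr, h⟩ := hX.2
  exact ⟨tensorComplex_isTame (X := X) (Y := Y) hX.1 hY.1, r, hr,
    CochainComplex.IsAcyclicAt.tensor (X := X) h Y⟩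

lemma tameAcyclic_coneEta (r : ℝ) (hr : 0 ≤ r) (X : CochainComplex (FiltVect k) ℤ)
    (hX : tame k (ho X)) : tameAcyclic k (ho (coneEta r hr X)) :=
  ⟨coneEta_isTame (X := X) r hr hX, r, hr, coneEta_isAcyclicAt r hr X⟩

/-- The biadditive product with `[X] * [Y] = [X ⊗ Y]`, for a class of complexes that is closed
under tensor products. -/
noncomputable def GrothendieckGroup.tensorMul (P : ObjectProperty (FiltHo k))
    (hP : ∀ X Y : CochainComplex (FiltVect k) ℤ, P (ho X) → P (ho Y) →
      P (ho (tensorComplex X Y))) :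
    GrothendieckGroup P →+ GrothendieckGroup P →+ GrothendieckGroup P :=
  GrothendieckGroup.lift
    (fun A hA => GrothendieckGroup.lift
      (fun B hB => GrothendieckGroup.mk (ho (tensorComplex A.as B.as)) (hP A.as B.as hA hB))
      (fun B₁ B₂ B₃ h₁ h₂ h₃ f g h hT => by
        obtain ⟨f', g', h', hT'⟩ := tensorComplex_preserves_right A.as B₁ B₂ B₃ f g h hT
        exact GrothendieckGroup.mk_eq_add _ _ _ f' g' h' hT'))
    (fun A₁ A₂ A₃ h₁ h₂ h₃ f g h hT => GrothendieckGroup.hom_ext fun B hB => by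
      obtain ⟨f', g', h', hT'⟩ := tensorComplex_preserves_left B.as A₁ A₂ A₃ f g h hT
      rw [AddMonoidHom.add_apply, GrothendieckGroup.lift_mk, GrothendieckGroup.lift_mk,
        GrothendieckGroup.lift_mk]
      exact GrothendieckGroup.mk_eq_add _ _ _ f' g' h' hT')

noncomputable instance : Mul (GrothendieckGroup (tame k)) :=
  ⟨fun x y => GrothendieckGroup.tensorMul (tame k) tame_tensorComplex x y⟩

noncomputable instance : Mul (GrothendieckGroup (tameAcyclic k)) :=
  ⟨fun x y => GrothendieckGroup.tensorMul (tameAcyclic k) tameAcyclic_tensorComplex x y⟩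

lemma GrothendieckGroup.mk_mul_mk (X Y : CochainComplex (FiltVect k) ℤ) (hX : tame k (ho X))
    (hY : tame k (ho Y)) :
    (mk (ho X) hX * mk (ho Y) hY : GrothendieckGroup (tame k)) =
      mk (ho (tensorComplex X Y)) (tame_tensorComplex X Y hX hY) := by
  change tensorMul (tame k) tame_tensorComplex (mk (ho X) hX) (mk (ho Y) hY) = _
  rw [tensorMul, lift_mk, lift_mk]
  rfl

lemma GrothendieckGroup.mk_mul_mk_acyclic (X Y : CochainComplex (FiltVect k) ℤ)
    (hX : tameAcyclic k (ho X)) (hY : tameAcyclic k (ho Y)) :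
    (mk (ho X) hX * mk (ho Y) hY : GrothendieckGroup (tameAcyclic k)) =
      mk (ho (tensorComplex X Y)) (tameAcyclic_tensorComplex X Y hX hY) := by
  change tensorMul (tameAcyclic k) tameAcyclic_tensorComplex (mk (ho X) hX) (mk (ho Y) hY) = _
  rw [tensorMul, lift_mk, lift_mk]
  rfl

variable (k) in
/-- The acyclic truncation map `Q_r : K(C^t) ⟶ KA(C^t)`. It sends the class of `X` to the class of
the third vertex of an exact triangle on `η_r : Σ^r X ⟶ X`, namely of the cone of `η_r`. -/
noncomputable def acyclicTruncation (r : ℝ) (hr : 0 ≤ r) :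
    GrothendieckGroup (tame k) →+ GrothendieckGroup (tameAcyclic k) :=
  GrothendieckGroup.lift
    (fun A hA => GrothendieckGroup.mk (ho (coneEta r hr A.as)) (tameAcyclic_coneEta r hr A.as hA))
    (fun A B C hA hB hC f g h hT => by
      obtain ⟨f', g', h', hT'⟩ := coneEta_preserves r hr A B C f g h hT
      exact GrothendieckGroup.mk_eq_add _ _ _ f' g' h' hT')

lemma acyclicTruncation_mk (r : ℝ) (hr : 0 ≤ r) (X : CochainComplex (FiltVect k) ℤ)
    (hX : tame k (ho X)) :
    acyclicTruncation k r hr (GrothendieckGroup.mk (ho X) hX) =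
      GrothendieckGroup.mk (ho (coneEta r hr X)) (tameAcyclic_coneEta r hr X hX) :=
  GrothendieckGroup.lift_mk _ _ _ _

end

/-! Write `σ` for the class of `Σ^r` acting on Grothendieck groups. The cone triangle of `η_r` says
that `Q_r`, followed by the map `KA ⟶ K` induced by inclusion (`GrothendieckGroup.ofLE`), is `1 -
σ`. Its inverse is the geometric series `1 + σ + σ² + ⋯`, and for `r > 0` this series is realized by
an actual functor, `S X = ⨁ₙ Σ^{nr} X` (`sigmaSum`). It preserves tameness: the filtration of `X` is
bounded below, so each level meets only finitely many summands. It preserves `t`-acyclicity, because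
one null homotopy serves all summands with the same bound `t`.

Splitting off the first summand gives a degreewise split sequence `X ⟶ S X ⟶ S Σ^r X` with `S Σ^r X
≅ Σ^r S X`, hence `[S X] = [X] + [Σ^r S X]` (`GrothendieckGroup.mk_sigmaSum`,
`GrothendieckGroup.mk_sigmaSum'`). In `K` this yields `S (1 - σ) = 1`, so `S` after inclusion is a
left inverse of `Q_r`. If `X` is acyclic, all the terms are acyclic, and the same relation in `KA`
shows that it is also a right inverse.

For the failure of multiplicativity, let `x` be the class of a line with filtration `0` in degree
`0`. In `K`, multiplicativity on `x, x` would force `1 - σ = (1 - σ)²` on `x`, that is, equate the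
classes of lines `[0] - [r]` and `[0] - 2[r] + [2r]`. The Euler characteristic of the subcomplex of
level `r`, additive on triangles by `levelEuler_triangle`, takes the values `0` and `-1` on them. -/

/-! ### Relations from split sequences, and functors applied degreewise -/

namespace GrothendieckGroup

variable {T : Type u} [Category.{v} T] [HasZeroObject T] [HasShift T ℤ]
  [Preadditive T] [∀ n : ℤ, (shiftFunctor T n).Additive] [Pretriangulated T]

/-- The map of Grothendieck groups induced by an inclusion of classes of objects. -/
def ofLE {P Q : ObjectProperty T} (h : P ≤ Q) : GrothendieckGroup P →+ GrothendieckGroup Q :=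
  lift (fun A hA => mk A (h A hA)) fun _ _ _ _ _ _ f g w hT => mk_eq_add _ _ _ f g w hT

@[simp]
lemma ofLE_mk {P Q : ObjectProperty T} (h : P ≤ Q) (A : T) (hA : P A) :
    ofLE h (mk A hA) = mk A (h A hA) :=
  lift_mk _ _ _ _

end GrothendieckGroup

section

variable {k : Type u} [Field k]

lemma IsDegreewiseSplit.exists_distTriang {X Y Z : CochainComplex (FiltVect k) ℤ} {f : X ⟶ Y}
    {g : Y ⟶ Z} (h : IsDegreewiseSplit f g) :
    ∃ (f' : ho X ⟶ ho Y) (g' : ho Y ⟶ ho Z) (h' : ho Z ⟶ (ho X)⟦(1 : ℤ)⟧),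
      Triangle.mk f' g' h' ∈ distTriang (FiltHo k) := by
  obtain ⟨w, h⟩ := h
  choose r s h₁ h₂ h₃ using h
  exact ⟨_, _, _, (HomotopyCategory.distinguished_iff_iso_trianglehOfDegreewiseSplit
    (CochainComplex.trianglehOfDegreewiseSplit (ShortComplex.mk _ _ w)
      (fun n => ⟨r n, s n, h₁ n, h₂ n, h₃ n⟩))).2 ⟨_, _, ⟨Iso.refl _⟩⟩⟩

/-- The relation of the cone triangle of `η_r`. The class `P` is arbitrary because the relation is
needed both in `K(C^t)` and, when `X` is itself acyclic, in `KA(C^t)`. -/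
lemma GrothendieckGroup.mk_eq_add_coneEta {P : ObjectProperty (FiltHo k)} (r : ℝ) (hr : 0 ≤ r)
    (X : CochainComplex (FiltVect k) ℤ) (hX : P (ho X)) (hσ : P (ho ((sigma k r).obj X)))
    (hc : P (ho (coneEta r hr X))) :
    mk (ho X) hX = mk (ho ((sigma k r).obj X)) hσ + mk (ho (coneEta r hr X)) hc :=
  mk_eq_add _ _ _ _ _ _
    (HomotopyCategory.mappingCone_triangleh_distinguished (etaMap r hr X))

lemma IsDegreewiseSplit.mapHomologicalComplex (G : FiltVect k ⥤ FiltVect k) [G.Additive]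
    {X Y Z : CochainComplex (FiltVect k) ℤ} {f : X ⟶ Y} {g : Y ⟶ Z}
    (h : IsDegreewiseSplit f g) :
    IsDegreewiseSplit ((G.mapHomologicalComplex (ComplexShape.up ℤ)).map f)
      ((G.mapHomologicalComplex (ComplexShape.up ℤ)).map g) := by
  obtain ⟨w, h⟩ := h
  refine ⟨by rw [← Functor.map_comp, w, Functor.map_zero], fun n => ?_⟩
  obtain ⟨ρ, σ, h₁, h₂, h₃⟩ := h n
  refine ⟨G.map ρ, G.map σ, ?_, ?_, ?_⟩
  · exact (G.map_comp _ _).symm.trans ((congrArg G.map h₁).trans (G.map_id _))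
  · exact (G.map_comp _ _).symm.trans ((congrArg G.map h₂).trans (G.map_id _))
  · refine Eq.trans ?_ ((congrArg G.map h₃).trans (G.map_id _))
    rw [G.map_add, G.map_comp, G.map_comp]
    rfl

lemma mapHomologicalComplex_preserves (G : FiltVect k ⥤ FiltVect k) [G.Additive] :
    PreservesTriangleVertices (k := k) (G.mapHomologicalComplex (ComplexShape.up ℤ)).obj :=
  preservesTriangleVertices_of_split _
    (fun _ _ ⟨e⟩ => ⟨HomotopyCategory.isoOfHomotopyEquiv
      (G.mapHomotopyEquiv (HomotopyCategory.homotopyEquivOfIso e))⟩)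
    (fun _ _ _ _ _ h => h.mapHomologicalComplex G)

/-- Applying `G` to a null homotopy of `X ⟶ Σ^{-r} X` gives one of `G X ⟶ G Σ^{-r} X`; the
comparison `θ` carries it to `Σ^{-r} G X`, and `hθ` identifies the resulting map with the canonical
one. The constant `r` is not worsened. -/
lemma CochainComplex.IsAcyclicAt.mapHomologicalComplex (G : FiltVect k ⥤ FiltVect k) [G.Additive]
    {r : ℝ} {hr : 0 ≤ r} (θ : FiltVect.shiftBy (-r) ⋙ G ⟶ G ⋙ FiltVect.shiftBy (-r))
    (hθ : ∀ V, G.map ((FiltVect.etaFrom r hr).app V) ≫ θ.app V = (FiltVect.etaFrom r hr).app _)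
    {X : CochainComplex (FiltVect k) ℤ} (h : X.IsAcyclicAt r hr) :
    CochainComplex.IsAcyclicAt
      ((G.mapHomologicalComplex (ComplexShape.up ℤ)).obj X) r hr := by
  rw [isAcyclicAt_iff] at h ⊢
  obtain ⟨h⟩ := h
  let t : (G.mapHomologicalComplex (ComplexShape.up ℤ)).obj ((sigma k (-r)).obj X) ⟶
      (sigma k (-r)).obj ((G.mapHomologicalComplex (ComplexShape.up ℤ)).obj X) :=
    { f := fun n => θ.app (X.X n)
      comm' := fun i j _ => (θ.naturality (X.d i j)).symm }
  refine ⟨(Homotopy.ofEq ?_).trans (((G.mapHomotopy h).compRight t).trans (Homotopy.ofEq ?_))⟩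
  · ext n : 1
    exact (hθ (X.X n)).symm
  · rw [Functor.map_zero, zero_comp]

/-! ### The geometric series of shifts on filtered vector spaces -/

namespace FiltVect

/-- The functor `V ↦ ⨁ₙ Σ^{nr} V`. -/
@[simps]
noncomputable def shiftSum (r : ℝ) : FiltVect k ⥤ FiltVect k where
  obj V :=
    -- When `r > 0` and `V` is bounded below, the level condition alone already forces `x n = 0` for
    -- large `n`. Finite support is thus what lets the levels exhaust the space.
    { carrier := ℕ →₀ V.carrier
      level := fun s =>
        { carrier := {x | ∀ n : ℕ, x n ∈ V.level (s - n * r)}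
          add_mem' := fun hx hy n => Submodule.add_mem _ (hx n) (hy n)
          zero_mem' := fun _ => Submodule.zero_mem _
          smul_mem' := fun c _ hx n => Submodule.smul_mem _ c (hx n) }
      mono := fun _ _ h _ hx n => V.mono (sub_le_sub_right h _) (hx n) }
  map f :=
    { lin := Finsupp.mapRange.linearMap f.lin
      map_level := fun _ x hx n => by
        simpa using f.map_level _ (x n) (hx n) }
  map_id V := hom_ext (LinearMap.ext fun x => Finsupp.ext fun n => by simp)
  map_comp f g := hom_ext (LinearMap.ext fun x => Finsupp.ext fun n => by simp)

instance (r : ℝ) : (shiftSum (k := k) r).Additive where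
  map_add := hom_ext (LinearMap.ext fun _ => Finsupp.ext fun _ => rfl)

variable (r : ℝ) (V : FiltVect k)

/-- The projection of `⨁ₙ Σ^{nr} V` to its summands. -/
noncomputable def shiftSumπ (n : ℕ) : (shiftSum r).obj V ⟶ (shiftBy (n * r)).obj V where
  lin := (Finsupp.lapply n : (ℕ →₀ V.carrier) →ₗ[k] V.carrier)
  map_level _ _ hx := hx n

/-- The projection of `⨁ₙ Σ^{nr} V` to its first summand. -/
noncomputable def shiftSumHead : (shiftSum r).obj V ⟶ V where
  lin := (Finsupp.lapply 0 : (ℕ →₀ V.carrier) →ₗ[k] V.carrier)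
  map_level := fun s (x : ℕ →₀ V.carrier) hx => by
    have h : x 0 ∈ V.level (s - (0 : ℕ) * r) := hx 0
    rwa [Nat.cast_zero, zero_mul, sub_zero] at h

/-- The inclusion of the first summand in `⨁ₙ Σ^{nr} V`. -/
noncomputable def shiftSumι : V ⟶ (shiftSum r).obj V where
  lin := (Finsupp.lsingle 0 : V.carrier →ₗ[k] (ℕ →₀ V.carrier))
  map_level s x hx := by
    change ∀ n : ℕ, Finsupp.single 0 x n ∈ V.level (s - n * r)
    rintro (_ | n)
    · simpa using hx
    · simp

/-- The projection of `⨁ₙ Σ^{nr} V` to the sum of all summands but the first, with its indices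
shifted by one. -/
noncomputable def shiftSumTail : (shiftSum r).obj V ⟶ (shiftSum r).obj ((shiftBy r).obj V) where
  lin := (Finsupp.lcomapDomain Nat.succ Nat.succ_injective :
    (ℕ →₀ V.carrier) →ₗ[k] (ℕ →₀ V.carrier))
  map_level := fun s (x : ℕ →₀ V.carrier) hx n => by
    -- The reindexing rests on `Σ^{(n+1)r} V = Σ^{nr} Σ^r V`.
    change x (n + 1) ∈ V.level (s - n * r - r)
    have h : x (n + 1) ∈ V.level (s - (n + 1 : ℕ) * r) := hx (n + 1)
    convert h using 2
    push_cast
    ring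

/-- The inclusion of the sum of all summands but the first in `⨁ₙ Σ^{nr} V`. -/
noncomputable def shiftSumCons : (shiftSum r).obj ((shiftBy r).obj V) ⟶ (shiftSum r).obj V where
  lin := (Finsupp.lmapDomain V.carrier k Nat.succ : (ℕ →₀ V.carrier) →ₗ[k] (ℕ →₀ V.carrier))
  map_level := fun s (x : ℕ →₀ V.carrier) hx => by
    change ∀ n : ℕ, Finsupp.mapDomain Nat.succ x n ∈ V.level (s - n * r)
    rintro (_ | n)
    · have : (Finsupp.mapDomain Nat.succ x) 0 = 0 := Finsupp.mapDomain_of_notMem_range _ _ (by simp)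
      exact this ▸ Submodule.zero_mem _
    · have : (Finsupp.mapDomain Nat.succ x) (n + 1) = x n :=
        Finsupp.mapDomain_apply Nat.succ_injective _ _
      have h : x n ∈ V.level (s - n * r - r) := hx n
      rw [this]
      convert h using 2
      push_cast
      ring

lemma shiftSumι_head : shiftSumι r V ≫ shiftSumHead r V = 𝟙 V :=
  hom_ext (LinearMap.ext fun _ => Finsupp.single_eq_same)

lemma shiftSumι_tail : shiftSumι r V ≫ shiftSumTail r V = 0 :=
  hom_ext (LinearMap.ext fun x => Finsupp.ext fun n => Finsupp.single_eq_of_ne (by simp))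

lemma shiftSumCons_tail : shiftSumCons r V ≫ shiftSumTail r V = 𝟙 _ :=
  hom_ext (LinearMap.ext fun _ => Finsupp.ext fun _ =>
    Finsupp.mapDomain_apply Nat.succ_injective _ _)

/-- The geometric series identity `S = 1 + S Σ^r`, as a direct sum decomposition: index `0` comes
from the head and every index `n + 1` from the tail. -/
lemma shiftSum_id : shiftSumHead r V ≫ shiftSumι r V + shiftSumTail r V ≫ shiftSumCons r V =
    𝟙 ((shiftSum r).obj V) := by
  refine hom_ext (LinearMap.ext fun (x : ℕ →₀ V.carrier) => Finsupp.ext fun n => ?_)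
  change Finsupp.single 0 (x 0) n +
    Finsupp.mapDomain Nat.succ (Finsupp.comapDomain Nat.succ x Nat.succ_injective.injOn) n = x n
  rcases n with _ | n
  · rw [Finsupp.single_eq_same, Finsupp.mapDomain_of_notMem_range _ _ (by simp), add_zero]
  · rw [Finsupp.single_eq_of_ne (by simp)]
    exact (zero_add _).trans (Finsupp.mapDomain_apply Nat.succ_injective _ _)

lemma shiftSumι_naturality {V W : FiltVect k} (f : V ⟶ W) :
    f ≫ shiftSumι r W = shiftSumι r V ≫ (shiftSum r).map f :=
  hom_ext (LinearMap.ext fun x => by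
    refine Eq.symm (Finsupp.mapRange_single (hf := map_zero f.lin)))

/-- Naturality is recorded only for the inclusion and the tail, which must be chain maps. The head
and the shifted inclusion serve as splittings degree by degree, so no compatibility with
differentials is asked of them. -/
lemma shiftSumTail_naturality {V W : FiltVect k} (f : V ⟶ W) :
    (shiftSum r).map f ≫ shiftSumTail r W =
      shiftSumTail r V ≫ (shiftSum r).map ((shiftBy r).map f) :=
  hom_ext (LinearMap.ext fun _ => Finsupp.ext fun _ => rfl)

/-- Shifts commute with `V ↦ ⨁ₙ Σ^{nr} V`. -/
noncomputable def shiftSumShift (t : ℝ) :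
    shiftBy t ⋙ shiftSum r ≅ shiftSum (k := k) r ⋙ shiftBy t :=
  NatIso.ofComponents (fun V =>
    { hom :=
        { lin := (LinearMap.id : (ℕ →₀ V.carrier) →ₗ[k] (ℕ →₀ V.carrier))
          map_level := fun s (x : ℕ →₀ V.carrier) hx n => by
            have h : x n ∈ V.level (s - n * r - t) := hx n
            rw [sub_right_comm] at h
            exact h }
      inv :=
        { lin := (LinearMap.id : (ℕ →₀ V.carrier) →ₗ[k] (ℕ →₀ V.carrier))
          map_level := fun s (x : ℕ →₀ V.carrier) hx n => by
            have h : x n ∈ V.level (s - t - n * r) := hx n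
            rw [sub_right_comm] at h
            exact h }
      hom_inv_id := rfl
      inv_hom_id := rfl })
    (fun _ => rfl)

variable {r V}

/-- Strict positivity of `r` is essential here: the `n`-th summand starts no lower than `s₀ + nr`,
which tends to infinity, so only finitely many summands contribute to a given level. -/
lemma shiftSum_good (hr : 0 < r) (hV : V.Good) {s₀ : ℝ} (h₀ : V.level s₀ = ⊥) :
    ((shiftSum r).obj V).Good := by
  refine Good.of_family (shiftSumπ r V) (fun x hx => Finsupp.ext hx) (fun s x hx => hx)
    (fun x => ?_) (fun n => ?_) (fun s => ?_)
  · exact (x : ℕ →₀ V.carrier).hasFiniteSupport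
  · exact hV.shiftBy _
  -- For `n ≥ N` one has `s - nr ≤ s₀`, so the `n`-th summand vanishes at level `s`.
  · obtain ⟨N, hN⟩ := exists_nat_gt ((s - s₀) / r)
    refine (Set.finite_Iio N).subset fun n hn => ?_
    by_contra! hle
    refine hn (le_bot_iff.1 (h₀ ▸ V.mono ?_))
    rw [Set.mem_Iio, not_lt] at hle
    rw [div_lt_iff₀ hr] at hN
    have : (N : ℝ) * r ≤ n * r := by gcongr
    linarith

/-- All shifts go upwards, so the sum inherits any lower bound of the filtration of `V`, and the
degrees that contribute at level `s` are among those of the original complex. -/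
lemma shiftSum_level_eq_bot (hr : 0 ≤ r) {s : ℝ} (h : V.level s = ⊥) :
    ((shiftSum r).obj V).level s = ⊥ := by
  refine le_bot_iff.1 fun (x : ℕ →₀ V.carrier) hx =>
    (Submodule.mem_bot k).2 (Finsupp.ext fun n => ?_)
  have : x n ∈ V.level s := V.mono (sub_le_self _ (by positivity)) (hx n)
  rwa [h, Submodule.mem_bot] at this

end FiltVect

variable (k) in
/-- The functor `X ↦ ⨁ₙ Σ^{nr} X` on filtered complexes. -/
noncomputable abbrev sigmaSum (r : ℝ) :
    CochainComplex (FiltVect k) ℤ ⥤ CochainComplex (FiltVect k) ℤ :=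
  (FiltVect.shiftSum r).mapHomologicalComplex _

/-! ### Shifts and sums of shifts of tame and of acyclic complexes -/

namespace CochainComplex

variable {X : CochainComplex (FiltVect k) ℤ} {r : ℝ}

lemma IsTame.sigma (h : X.IsTame) (r : ℝ) : ((sigma k r).obj X).IsTame where
  finite_degrees s := h.finite_degrees (s - r)
  finiteDimensional s i := h.finiteDimensional (s - r) i
  bounded_below := by
    obtain ⟨s, hs⟩ := h.bounded_below
    exact ⟨s + r, fun i => by change (X.X i).level _ = ⊥; simpa using hs i⟩
  exhaustive i := ((h.good i).shiftBy r).exhaustive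
  right_continuous i := ((h.good i).shiftBy r).right_continuous

lemma IsTame.sigmaSum (h : X.IsTame) (hr : 0 < r) : ((sigmaSum k r).obj X).IsTame := by
  obtain ⟨s₀, hs₀⟩ := h.bounded_below
  have hg (i : ℤ) := FiltVect.shiftSum_good hr (h.good i) (hs₀ i)
  refine ⟨fun s => (h.finite_degrees s).subset fun i hi hs => ?_,
    fun s i => (hg i).finiteDimensional s, ⟨s₀, fun i => ?_⟩,
    fun i => (hg i).exhaustive, fun i => (hg i).right_continuous⟩
  · exact hi (FiltVect.shiftSum_level_eq_bot hr.le hs)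
  · exact FiltVect.shiftSum_level_eq_bot hr.le (hs₀ i)

lemma IsAcyclicAt.sigma {t : ℝ} {ht : 0 ≤ t} (h : X.IsAcyclicAt t ht) (r : ℝ) :
    ((sigma k r).obj X).IsAcyclicAt t ht :=
  IsAcyclicAt.mapHomologicalComplex (FiltVect.shiftBy r)
    { app := fun V => ⟨(LinearMap.id : V.carrier →ₗ[k] V.carrier), fun s x hx => by
        have h : x ∈ V.level (s - r - -t) := hx
        rwa [sub_right_comm] at h⟩
      naturality := fun _ _ _ => rfl } (fun _ => rfl) h

/-- The summands are shifts of one complex, so a single homotopy with bound `t` contracts them all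
at once. A sum of complexes with unbounded acyclicity constants would not do. -/
lemma IsAcyclicAt.sigmaSum {t : ℝ} {ht : 0 ≤ t} (h : X.IsAcyclicAt t ht) (r : ℝ) :
    ((sigmaSum k r).obj X).IsAcyclicAt t ht :=
  IsAcyclicAt.mapHomologicalComplex (FiltVect.shiftSum r)
    (FiltVect.shiftSumShift r (-t)).hom
    (fun _ => FiltVect.hom_ext (LinearMap.ext fun _ => Finsupp.ext fun _ => rfl)) h

end CochainComplex

lemma tame_sigma (r : ℝ) (X : CochainComplex (FiltVect k) ℤ) (h : tame k (ho X)) :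
    tame k (ho ((sigma k r).obj X)) :=
  CochainComplex.IsTame.sigma (X := X) h r

lemma tameAcyclic_sigma (r : ℝ) (X : CochainComplex (FiltVect k) ℤ) (h : tameAcyclic k (ho X)) :
    tameAcyclic k (ho ((sigma k r).obj X)) := by
  obtain ⟨h, t, ht, h'⟩ := h
  exact ⟨CochainComplex.IsTame.sigma (X := X) h r, t, ht,
    CochainComplex.IsAcyclicAt.sigma (X := X) h' r⟩

lemma tame_sigmaSum {r : ℝ} (hr : 0 < r) (X : CochainComplex (FiltVect k) ℤ)
    (h : tame k (ho X)) : tame k (ho ((sigmaSum k r).obj X)) :=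
  CochainComplex.IsTame.sigmaSum (X := X) h hr

lemma tameAcyclic_sigmaSum {r : ℝ} (hr : 0 < r) (X : CochainComplex (FiltVect k) ℤ)
    (h : tameAcyclic k (ho X)) : tameAcyclic k (ho ((sigmaSum k r).obj X)) := by
  obtain ⟨h, t, ht, h'⟩ := h
  exact ⟨CochainComplex.IsTame.sigmaSum (X := X) h hr, t, ht,
    CochainComplex.IsAcyclicAt.sigmaSum (X := X) h' r⟩

/-- The isomorphism `⨁ₙ Σ^{nr} Σ^t X ≅ Σ^t ⨁ₙ Σ^{nr} X`. -/
noncomputable def sigmaSumSigma (r t : ℝ) (X : CochainComplex (FiltVect k) ℤ) :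
    (sigmaSum k r).obj ((sigma k t).obj X) ≅ (sigma k t).obj ((sigmaSum k r).obj X) :=
  HomologicalComplex.Hom.isoOfComponents (fun n => (FiltVect.shiftSumShift r t).app (X.X n))
    (fun i j _ => ((FiltVect.shiftSumShift r t).hom.naturality (X.d i j)).symm)

/-- The first summand splits off in each degree, and what remains is the same series applied to `Σ^r
X`. -/
lemma sigmaSum_exists_distTriang (r : ℝ) (X : CochainComplex (FiltVect k) ℤ) :
    ∃ (f : ho X ⟶ ho ((sigmaSum k r).obj X))
      (g : ho ((sigmaSum k r).obj X) ⟶ ho ((sigmaSum k r).obj ((sigma k r).obj X)))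
      (h : ho ((sigmaSum k r).obj ((sigma k r).obj X)) ⟶ (ho X)⟦(1 : ℤ)⟧),
      Triangle.mk f g h ∈ distTriang (FiltHo k) := by
  let f : X ⟶ (sigmaSum k r).obj X :=
    { f := fun n => FiltVect.shiftSumι r (X.X n)
      comm' := fun i j _ => (FiltVect.shiftSumι_naturality r (X.d i j)).symm }
  let g : (sigmaSum k r).obj X ⟶ (sigmaSum k r).obj ((sigma k r).obj X) :=
    { f := fun n => FiltVect.shiftSumTail r (X.X n)
      comm' := fun i j _ => (FiltVect.shiftSumTail_naturality r (X.d i j)).symm }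
  refine IsDegreewiseSplit.exists_distTriang (f := f) (g := g)
    ⟨HomologicalComplex.hom_ext _ _ fun n => FiltVect.shiftSumι_tail r (X.X n), fun n =>
      ⟨FiltVect.shiftSumHead r (X.X n), FiltVect.shiftSumCons r (X.X n),
        FiltVect.shiftSumι_head r _, FiltVect.shiftSumCons_tail r _, FiltVect.shiftSum_id r _⟩⟩

namespace GrothendieckGroup

variable {P : ObjectProperty (FiltHo k)}

/-- The form with `S Σ^r X`, suited to composing `S` after `1 - σ`. -/
lemma mk_sigmaSum (r : ℝ) (X : CochainComplex (FiltVect k) ℤ) (hX : P (ho X))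
    (hS : P (ho ((sigmaSum k r).obj X)))
    (hSσ : P (ho ((sigmaSum k r).obj ((sigma k r).obj X)))) :
    mk _ hS = mk _ hX + mk _ hSσ := by
  obtain ⟨f, g, h, hT⟩ := sigmaSum_exists_distTriang r X
  exact mk_eq_add _ _ _ f g h hT

/-- The form with `Σ^r S X`, suited to comparison with the cone of `η_r` on `S X`. -/
lemma mk_sigmaSum' (r : ℝ) (X : CochainComplex (FiltVect k) ℤ) (hX : P (ho X))
    (hS : P (ho ((sigmaSum k r).obj X)))
    (hσS : P (ho ((sigma k r).obj ((sigmaSum k r).obj X)))) :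
    mk _ hS = mk _ hX + mk _ hσS := by
  obtain ⟨f, g, h, hT⟩ := sigmaSum_exists_distTriang r X
  obtain ⟨f', g', h', hT'⟩ := exists_distTriang_of_iso hT (Iso.refl _) (Iso.refl _)
    ((HomotopyCategory.quotient _ _).mapIso (sigmaSumSigma r r X).symm)
  exact mk_eq_add _ _ _ f' g' h' hT'

end GrothendieckGroup

/-! ### Bijectivity of the acyclic truncation -/

lemma tameAcyclic_le_tame : tameAcyclic k ≤ tame k := fun _ h => h.1

variable (k) in
/-- The endomorphism of `K(C^t)` with `[X] ↦ [⨁ₙ Σ^{nr} X]`. -/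
noncomputable def sumShifts (r : ℝ) (hr : 0 < r) :
    GrothendieckGroup (tame k) →+ GrothendieckGroup (tame k) :=
  GrothendieckGroup.lift
    (fun A hA => GrothendieckGroup.mk (ho ((sigmaSum k r).obj A.as)) (tame_sigmaSum hr A.as hA))
    (fun A B C _ _ _ f g h hT => by
      obtain ⟨f', g', h', hT'⟩ := mapHomologicalComplex_preserves (FiltVect.shiftSum r) A B C f g h hT
      exact GrothendieckGroup.mk_eq_add _ _ _ f' g' h' hT')

lemma sumShifts_mk (r : ℝ) (hr : 0 < r) (X : CochainComplex (FiltVect k) ℤ)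
    (hX : tame k (ho X)) :
    sumShifts k r hr (GrothendieckGroup.mk (ho X) hX) =
      GrothendieckGroup.mk (ho ((sigmaSum k r).obj X)) (tame_sigmaSum hr X hX) :=
  GrothendieckGroup.lift_mk _ _ _ _

/-- This is `Q_r = 1 - σ`. It is read in `K(C^t)`, since `X` and `Σ^r X` need not be acyclic. -/
lemma ofLE_acyclicTruncation_mk (r : ℝ) (hr : 0 ≤ r) (X : CochainComplex (FiltVect k) ℤ)
    (hX : tame k (ho X)) :
    GrothendieckGroup.ofLE tameAcyclic_le_tame
        (acyclicTruncation k r hr (GrothendieckGroup.mk (ho X) hX)) =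
      GrothendieckGroup.mk (ho X) hX -
        GrothendieckGroup.mk (ho ((sigma k r).obj X)) (tame_sigma r X hX) := by
  rw [acyclicTruncation_mk, GrothendieckGroup.ofLE_mk, eq_sub_iff_add_eq',
    ← GrothendieckGroup.mk_eq_add_coneEta]

/-- The left inverse is the geometric series after inclusion: `S (1 - σ) = 1` by telescoping. -/
lemma acyclicTruncation_injective {r : ℝ} (hr : 0 < r) :
    Function.Injective (acyclicTruncation k r hr.le) := by
  refine Function.LeftInverse.injective
    (g := (sumShifts k r hr).comp (GrothendieckGroup.ofLE tameAcyclic_le_tame)) fun x => ?_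
  refine DFunLike.congr_fun (f := ((sumShifts k r hr).comp
    (GrothendieckGroup.ofLE tameAcyclic_le_tame)).comp (acyclicTruncation k r hr.le))
    (g := AddMonoidHom.id _) (GrothendieckGroup.hom_ext fun A hA => ?_) x
  change sumShifts k r hr (GrothendieckGroup.ofLE tameAcyclic_le_tame
    (acyclicTruncation k r hr.le (GrothendieckGroup.mk (ho A.as) hA))) =
      GrothendieckGroup.mk (ho A.as) hA
  refine (congrArg (sumShifts k r hr) (ofLE_acyclicTruncation_mk r hr.le A.as hA)).trans ?_
  rw [map_sub, sub_eq_iff_eq_add]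
  exact (sumShifts_mk r hr _ _).trans ((GrothendieckGroup.mk_sigmaSum r A.as hA _ _).trans
    (congrArg _ (sumShifts_mk r hr _ _).symm))

/-- The same map is a right inverse. The computation takes place in `KA(C^t)` itself, which is
possible because `S A` and `Σ^r S A` are acyclic along with `A`. -/
lemma acyclicTruncation_surjective {r : ℝ} (hr : 0 < r) :
    Function.Surjective (acyclicTruncation k r hr.le) := by
  refine Function.RightInverse.surjective
    (g := (sumShifts k r hr).comp (GrothendieckGroup.ofLE tameAcyclic_le_tame)) fun x => ?_
  refine DFunLike.congr_fun (f := (acyclicTruncation k r hr.le).comp ((sumShifts k r hr).comp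
    (GrothendieckGroup.ofLE tameAcyclic_le_tame)))
    (g := AddMonoidHom.id _) (GrothendieckGroup.hom_ext fun A hA => ?_) x
  have hS := tameAcyclic_sigmaSum hr A.as hA
  have h := GrothendieckGroup.mk_eq_add_coneEta r hr.le ((sigmaSum k r).obj A.as) hS
    (tameAcyclic_sigma r _ hS) (tameAcyclic_coneEta r hr.le _ hS.1)
  have h' := GrothendieckGroup.mk_sigmaSum' r A.as hA hS (tameAcyclic_sigma r _ hS)
  change acyclicTruncation k r hr.le (sumShifts k r hr
    (GrothendieckGroup.ofLE tameAcyclic_le_tame (GrothendieckGroup.mk A hA))) =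
      GrothendieckGroup.mk A hA
  refine (congrArg (acyclicTruncation k r hr.le) (sumShifts_mk r hr A.as hA.1)).trans ?_
  refine (acyclicTruncation_mk r hr.le ((sigmaSum k r).obj A.as) hS.1).trans ?_
  -- Two expressions for `[S A]` in `KA(C^t)`: cone of `η_r` plus `Σ^r S A`, and `A` plus `Σ^r S A`.
  -- Cancelling the common term leaves the claim.
  rw [h, add_comm] at h'
  exact add_right_cancel h'

end

/-! ### Alternating sums of dimensions in a long exact sequence -/

lemma finsum_negOnePow_mul_sub_one (c : ℤ → ℤ) :
    ∑ᶠ n : ℤ, (n.negOnePow : ℤ) * c (n - 1) = -∑ᶠ n : ℤ, (n.negOnePow : ℤ) * c n := by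
  rw [← finsum_neg_distrib, ← finsum_comp_equiv (Equiv.subRight (1 : ℤ))
    (f := fun n : ℤ => -((n.negOnePow : ℤ) * c n))]
  exact finsum_congr fun n => by simp [Int.negOnePow_sub]

/-- With `a`, `b`, `c` the ranks of `f`, `g`, `d`, exactness and rank-nullity give `dim A n = c (n -
1) + a n`, `dim B n = a n + b n` and `dim C n = b n + c n`. In the alternating sum the two
contributions of `c` cancel, being offset by one degree. -/
lemma finsum_negOnePow_finrank_of_exact {k : Type*} [Field k] {A B C : ℤ → Type*}
    [∀ n, AddCommGroup (A n)] [∀ n, Module k (A n)] [∀ n, AddCommGroup (B n)]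
    [∀ n, Module k (B n)] [∀ n, AddCommGroup (C n)] [∀ n, Module k (C n)]
    [∀ n, FiniteDimensional k (A n)] [∀ n, FiniteDimensional k (B n)]
    [∀ n, FiniteDimensional k (C n)]
    (hA : {n | Module.finrank k (A n) ≠ 0}.Finite) (hC : {n | Module.finrank k (C n) ≠ 0}.Finite)
    (f : ∀ n, A n →ₗ[k] B n) (g : ∀ n, B n →ₗ[k] C n) (d : ∀ m n, m + 1 = n → C m →ₗ[k] A n)
    (h₂ : ∀ n, Function.Exact (f n) (g n)) (h₃ : ∀ m n h, Function.Exact (g m) (d m n h))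
    (h₁ : ∀ m n h, Function.Exact (d m n h) (f n)) :
    ∑ᶠ n : ℤ, (n.negOnePow : ℤ) * (Module.finrank k (B n) : ℤ) =
      ∑ᶠ n : ℤ, (n.negOnePow : ℤ) * (Module.finrank k (A n) : ℤ) +
        ∑ᶠ n : ℤ, (n.negOnePow : ℤ) * (Module.finrank k (C n) : ℤ) := by
  let a (n : ℤ) : ℤ := Module.finrank k (LinearMap.range (f n))
  let b (n : ℤ) : ℤ := Module.finrank k (LinearMap.range (g n))
  let c (n : ℤ) : ℤ := Module.finrank k (LinearMap.range (d n (n + 1) rfl))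
  have hd (m n : ℤ) (h : m + 1 = n) :
      c m = Module.finrank k (LinearMap.range (d m n h)) := by subst h; rfl
  have eA (n : ℤ) : (Module.finrank k (A n) : ℤ) = c (n - 1) + a n := by
    have := (f n).finrank_range_add_finrank_ker
    rw [(h₁ (n - 1) n (by simp)).linearMap_ker_eq] at this
    rw [hd (n - 1) n (by simp), ← this, add_comm]
    push_cast
    rfl
  have eB (n : ℤ) : (Module.finrank k (B n) : ℤ) = a n + b n := by
    have := (g n).finrank_range_add_finrank_ker
    rw [(h₂ n).linearMap_ker_eq] at this
    rw [← this, add_comm]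
    push_cast
    rfl
  have eC (n : ℤ) : (Module.finrank k (C n) : ℤ) = b n + c n := by
    have := (d n (n + 1) rfl).finrank_range_add_finrank_ker
    rw [(h₃ n (n + 1) rfl).linearMap_ker_eq] at this
    rw [← this, add_comm]
    push_cast
    rfl
  -- Finite supports are needed to split the sums, as `finsum` is additive only then. The ranks are
  -- bounded by the dimensions of `A` and `C`, so nothing has to be assumed on `B`.
  have fa : {n | a n ≠ 0}.Finite := hA.subset fun n hn h => by
    have := eA n
    simp only [h, a, c] at this
    simp only [Set.mem_ofPred_eq, a] at hn
    omega
  have fb : {n | b n ≠ 0}.Finite := hC.subset fun n hn h => by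
    have := eC n
    simp only [h, b, c] at this
    simp only [Set.mem_ofPred_eq, b] at hn
    omega
  have fc : {n | c n ≠ 0}.Finite := hC.subset fun n hn h => by
    have := eC n
    simp only [h, b, c] at this
    simp only [Set.mem_ofPred_eq, c] at hn
    omega
  have supp {e : ℤ → ℤ} (he : {n | e n ≠ 0}.Finite) :
      (Function.support fun n : ℤ => (n.negOnePow : ℤ) * e n).Finite :=
    he.subset fun n hn h => hn (by simp [h])
  have fc' : {n | c (n - 1) ≠ 0}.Finite := fc.preimage (sub_left_injective (b := (1 : ℤ))).injOn
  simp only [eA, eB, eC, mul_add]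
  rw [finsum_add_distrib (supp fa) (supp fb), finsum_add_distrib (supp fc') (supp fa),
    finsum_add_distrib (supp fb) (supp fc), finsum_negOnePow_mul_sub_one]
  ring

/-! ### Euler characteristics of sublevel complexes -/

section

variable {k : Type u} [Field k]

/-- The functor `V ↦ V^{≤ s}`. -/
@[simps]
noncomputable def FiltVect.levelFunctor (s : ℝ) : FiltVect k ⥤ ModuleCat.{u} k where
  obj V := ModuleCat.of k (V.level s)
  map f := ModuleCat.ofHom (f.lin.restrict (f.map_level s))
  map_id _ := rfl
  map_comp _ _ := rfl

instance (s : ℝ) : (FiltVect.levelFunctor (k := k) s).Additive where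
  map_add := rfl

/-- The homology in degree `n` of the complexes of vectors of level `s`. -/
noncomputable def levelHomology (s : ℝ) (n : ℤ) : FiltHo k ⥤ ModuleCat.{u} k :=
  (FiltVect.levelFunctor s).mapHomotopyCategory (ComplexShape.up ℤ) ⋙
    HomotopyCategory.homologyFunctor (ModuleCat.{u} k) (ComplexShape.up ℤ) n

/-- The homology of the complex of vectors of level `s`. -/
noncomputable def levelHomologyIso (s : ℝ) (n : ℤ) (X : CochainComplex (FiltVect k) ℤ) :
    (levelHomology s n).obj (ho X) ≅
      (((FiltVect.levelFunctor s).mapHomologicalComplex (ComplexShape.up ℤ)).obj X).homology n :=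
  (HomotopyCategory.homologyFunctorFactors (ModuleCat.{u} k) (ComplexShape.up ℤ) n).app _

lemma levelHomology_isZero (s : ℝ) (n : ℤ) (X : CochainComplex (FiltVect k) ℤ)
    (h : (X.X n).level s = ⊥) : IsZero ((levelHomology s n).obj (ho X)) := by
  refine IsZero.of_iso (ShortComplex.isZero_homology_of_isZero_X₂ _ ?_) (levelHomologyIso s n X)
  have : Subsingleton ((X.X n).level s) := by rw [h]; infer_instance
  exact ModuleCat.isZero_of_subsingleton (ModuleCat.of k ((X.X n).level s))

lemma levelHomology_finite (s : ℝ) (n : ℤ) (X : CochainComplex (FiltVect k) ℤ)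
    (h : FiniteDimensional k ((X.X n).level s)) :
    FiniteDimensional k ((levelHomology s n).obj (ho X)) := by
  let K := ((FiltVect.levelFunctor s).mapHomologicalComplex (ComplexShape.up ℤ)).obj X
  have : FiniteDimensional k (K.X n) := h
  have : FiniteDimensional k (K.cycles n) :=
    Module.Finite.of_injective (K.iCycles n).hom ((ModuleCat.mono_iff_injective _).1 inferInstance)
  have : FiniteDimensional k (K.homology n) :=
    Module.Finite.of_surjective (K.homologyπ n).hom
      ((ModuleCat.epi_iff_surjective _).1 inferInstance)
  exact Module.Finite.equiv (levelHomologyIso s n X).toLinearEquiv.symm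

/-- The Euler characteristic of the complex of vectors of level `s`. -/
noncomputable def levelEuler (s : ℝ) (A : FiltHo k) : ℤ :=
  ∑ᶠ n : ℤ, (n.negOnePow : ℤ) * (Module.finrank k ((levelHomology s n).obj A) : ℤ)

lemma levelHomology_finite_support (s : ℝ) (X : CochainComplex (FiltVect k) ℤ)
    (h : X.IsTame) : {n | Module.finrank k ((levelHomology s n).obj (ho X)) ≠ 0}.Finite :=
  (h.finite_degrees s).subset fun n hn h0 => hn (by
    have := ModuleCat.subsingleton_of_isZero (levelHomology_isZero s n X h0)
    exact Module.finrank_zero_of_subsingleton)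

/-- Taking level `s` is an additive functor to vector spaces, so it carries exact triangles to exact
triangles of the homotopy category, and these have long exact homology sequences. Tameness makes all
the dimensions finite and almost all of them zero. -/
lemma levelEuler_triangle (s : ℝ) {A B C : FiltHo k} (hA : tame k A) (hB : tame k B)
    (hC : tame k C) (f : A ⟶ B) (g : B ⟶ C) (h : C ⟶ A⟦(1 : ℤ)⟧)
    (hT : Triangle.mk f g h ∈ distTriang (FiltHo k)) :
    levelEuler s B = levelEuler s A + levelEuler s C := by
  let G := (FiltVect.levelFunctor (k := k) s).mapHomotopyCategory (ComplexShape.up ℤ)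
  let T := G.mapTriangle.obj (Triangle.mk f g h)
  have hT' : T ∈ distTriang _ := G.map_distinguished _ hT
  let F := HomotopyCategory.homologyFunctor (ModuleCat.{u} k) (ComplexShape.up ℤ) 0
  have := fun n => levelHomology_finite s n A.as (CochainComplex.IsTame.finiteDimensional hA s n)
  have := fun n => levelHomology_finite s n B.as (CochainComplex.IsTame.finiteDimensional hB s n)
  have := fun n => levelHomology_finite s n C.as (CochainComplex.IsTame.finiteDimensional hC s n)
  exact finsum_negOnePow_finrank_of_exact
    (A := fun n => (levelHomology s n).obj (ho A.as))
    (B := fun n => (levelHomology s n).obj (ho B.as))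
    (C := fun n => (levelHomology s n).obj (ho C.as))
    (levelHomology_finite_support s A.as hA) (levelHomology_finite_support s C.as hC)
    (fun n => ((levelHomology s n).map f).hom) (fun n => ((levelHomology s n).map g).hom)
    (fun m n hmn => (F.homologySequenceδ T m n hmn).hom)
    (fun n => (ShortComplex.ShortExact.moduleCat_exact_iff_function_exact _).1
      (F.homologySequence_exact₂ _ hT' n))
    (fun m n hmn => (ShortComplex.ShortExact.moduleCat_exact_iff_function_exact _).1
      (F.homologySequence_exact₃ _ hT' m n hmn))
    (fun m n hmn => (ShortComplex.ShortExact.moduleCat_exact_iff_function_exact _).1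
      (F.homologySequence_exact₁ _ hT' m n hmn))

variable (k) in
/-- The Euler characteristic of the complex of vectors of level `s`, on the Grothendieck group. -/
noncomputable def eulerHom (s : ℝ) : GrothendieckGroup (tame k) →+ ℤ :=
  GrothendieckGroup.lift (fun A _ => levelEuler s A)
    fun _ _ _ hA hB hC f g h hT => levelEuler_triangle s hA hB hC f g h hT

lemma eulerHom_mk (s : ℝ) (A : FiltHo k) (hA : tame k A) :
    eulerHom k s (GrothendieckGroup.mk A hA) = levelEuler s A :=
  GrothendieckGroup.lift_mk _ _ _ _

/-- With both neighbours of degree `0` zero, the homology there is the whole term, and it enters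
with sign `+1`. -/
lemma levelEuler_of_isZero (s : ℝ) (X : CochainComplex (FiltVect k) ℤ)
    (hX : ∀ n, n ≠ 0 → IsZero (X.X n)) :
    levelEuler s (ho X) = Module.finrank k ((X.X 0).level s) := by
  let K := ((FiltVect.levelFunctor s).mapHomologicalComplex (ComplexShape.up ℤ)).obj X
  have hz (n : ℤ) (hn : n ≠ 0) : IsZero (K.X n) :=
    (FiltVect.levelFunctor s).map_isZero (hX n hn)
  have e : (K.sc 0).homology ≅ K.X 0 :=
    (ShortComplex.HomologyData.ofZeros (K.sc 0)
      ((hz _ (by simp)).eq_of_src _ _) ((hz _ (by simp)).eq_of_tgt _ _)).left.homologyIso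
  rw [levelEuler, finsum_eq_single _ 0]
  · have := (levelHomologyIso s 0 X ≪≫ e).toLinearEquiv.finrank_eq
    rw [this]
    simp
    rfl
  · intro n hn
    have hl : (X.X n).level s = ⊥ := by
      have := ModuleCat.subsingleton_of_isZero (hz n hn)
      exact (Submodule.subsingleton_iff_eq_bot).1 this
    have := ModuleCat.subsingleton_of_isZero (levelHomology_isZero s n X hl)
    rw [Module.finrank_zero_of_subsingleton]
    simp

end

/-! ### Lines, their shifts and their tensor products -/

section

variable {k : Type u} [Field k]

namespace FiltVect

open Classical in
variable (k) in
/-- The line whose nonzero vectors have filtration `a`. -/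
noncomputable def line (a : ℝ) : FiltVect k where
  carrier := k
  -- The inequality is not strict, so that the infimum `a` of the levels of a nonzero vector is
  -- attained, as tameness demands.
  level s := if a ≤ s then ⊤ else ⊥
  mono s t h := by
    beta_reduce
    split_ifs with h₁ h₂
    · exact le_rfl
    · exact absurd (h₁.trans h) h₂
    · exact bot_le
    · exact le_rfl

lemma line_level_of_le {a s : ℝ} (h : a ≤ s) : (line k a).level s = ⊤ := if_pos h

lemma line_level_of_lt {a s : ℝ} (h : s < a) : (line k a).level s = ⊥ := if_neg h.not_ge

lemma finrank_line_level (a s : ℝ) [Decidable (a ≤ s)] :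
    Module.finrank k ((line k a).level s) = if a ≤ s then 1 else 0 := by
  split_ifs with h
  · rw [line_level_of_le h, finrank_top]
    exact Module.finrank_self k
  · rw [line_level_of_lt (not_le.1 h), finrank_bot]

lemma line_good (a : ℝ) : (line k a).Good where
  finiteDimensional s := by
    have : FiniteDimensional k (line k a).carrier := inferInstanceAs (FiniteDimensional k k)
    infer_instance
  exhaustive x := ⟨a, by rw [line_level_of_le le_rfl]; trivial⟩
  right_continuous s x h := by
    rcases le_or_gt a s with hs | hs
    · rw [line_level_of_le hs]
      trivial
    · obtain ⟨t, ht, hta⟩ := exists_between hs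
      have := h t ht
      rw [line_level_of_lt hta] at this
      rw [(Submodule.mem_bot k).1 this]
      exact Submodule.zero_mem _

lemma mem_line_level {a s : ℝ} {x : (line k a).carrier} :
    x ∈ (line k a).level s ↔ x = 0 ∨ a ≤ s := by
  rcases le_or_gt a s with h | h
  · simp [line_level_of_le h, h]
  · simp [line_level_of_lt h, h]

/-- Shifting a line. -/
noncomputable def shiftByLine (r a : ℝ) : (shiftBy r).obj (line k a) ≅ line k (a + r) where
  hom :=
    { lin := (LinearMap.id : k →ₗ[k] k)
      map_level := fun _ (_ : (line k a).carrier) hx =>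
        mem_line_level.2 ((mem_line_level.1 hx).imp id le_sub_iff_add_le.1) }
  inv :=
    { lin := (LinearMap.id : k →ₗ[k] k)
      map_level := fun _ (_ : (line k (a + r)).carrier) hx =>
        mem_line_level (k := k) (a := a).2 ((mem_line_level.1 hx).imp id le_sub_iff_add_le.2) }
  hom_inv_id := rfl
  inv_hom_id := rfl

/-- The tensor product of two lines. -/
noncomputable def tensorLine (a b : ℝ) :
    tensorObj (line k a) (line k b) ≅ line k (a + b) where
  hom :=
    { lin := (TensorProduct.lid k k).toLinearMap
      map_level := fun s z hz => by
        refine (Submodule.span_le (p := ((line k (a + b)).level s).comap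
          (TensorProduct.lid k k).toLinearMap)).2 ?_ hz
        rintro _ ⟨a', b', hab, x, hx, y, hy, rfl⟩
        refine mem_line_level.2 ?_
        rcases mem_line_level.1 hx with hx | hx
        · subst hx
          exact Or.inl (zero_mul (show k from y))
        rcases mem_line_level.1 hy with hy | hy
        -- A generator with both factors nonzero has `a ≤ a'` and `b ≤ b'`, hence threshold at least
        -- `a + b`; otherwise it is zero.
        · subst hy
          exact Or.inl (mul_zero (show k from x))
        · exact Or.inr ((add_le_add hx hy).trans hab) }
  inv :=
    { lin := (TensorProduct.lid k k).symm.toLinearMap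
      map_level := fun s x hx => by
        rcases mem_line_level.1 hx with h | h
        · subst h
          exact (congrArg (· ∈ (tensorObj (line k a) (line k b)).level s)
            (map_zero (TensorProduct.lid k k).symm)).mpr (Submodule.zero_mem _)
        -- The preimage of `x` is `1 ⊗ x`, whose factors have levels exactly `a` and `b`.
        · exact Submodule.subset_span (R := k) (M := k ⊗[k] k)
            ⟨a, b, h, (1 : k), mem_line_level.2 (Or.inr le_rfl), x,
              mem_line_level.2 (Or.inr le_rfl), rfl⟩ }
  hom_inv_id := hom_ext (LinearMap.ext (TensorProduct.lid k k).symm_apply_apply)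
  inv_hom_id := hom_ext (LinearMap.ext (TensorProduct.lid k k).apply_symm_apply)

lemma level_finrank_eq_of_iso {V W : FiltVect k} (e : V ≅ W) (s : ℝ) :
    Module.finrank k (V.level s) = Module.finrank k (W.level s) :=
  ((levelFunctor s).mapIso e).toLinearEquiv.finrank_eq

lemma level_eq_bot_of_isZero {V : FiltVect k} (h : IsZero V) (s : ℝ) : V.level s = ⊥ := by
  have := ModuleCat.subsingleton_of_isZero ((levelFunctor s).map_isZero h)
  exact (Submodule.subsingleton_iff_eq_bot).1 this

lemma Good.of_iso {V W : FiltVect k} (e : V ≅ W) (hW : W.Good) : V.Good := by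
  have he (x) : e.inv.lin (e.hom.lin x) = x :=
    congrArg (fun f => FiltVect.Hom.lin f x) e.hom_inv_id
  refine Good.of_family (J := Unit) (fun _ => e.hom) (fun x hx => ?_) (fun s x hx => ?_)
    (fun _ => Set.toFinite _) (fun _ => hW) (fun _ => Set.toFinite _)
  · rw [← he x, hx (), map_zero]
  · rw [← he x]
    exact e.inv.map_level s _ (hx ())

lemma good_of_isZero {V : FiltVect k} (h : IsZero V) : V.Good :=
  -- On a zero object the empty family of projections is already jointly injective; `line k 0` only
  -- fills in the type.
  Good.of_family (J := Empty) (A := fun _ => line k 0) (fun j => j.elim)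
    (fun x _ => congrArg (fun f => FiltVect.Hom.lin f x) ((IsZero.iff_id_eq_zero V).1 h))
    (fun s x _ => by
      rw [show x = 0 from congrArg (fun f => FiltVect.Hom.lin f x) ((IsZero.iff_id_eq_zero V).1 h)]
      exact Submodule.zero_mem _) (fun _ => Set.toFinite _) (fun j => j.elim)
    (fun _ => Set.toFinite _)

end FiltVect

open HomologicalComplex in
-- If `i + j = n ≠ 0`, then `i` or `j` is nonzero, so every summand in degree `n` has a zero factor.
lemma tensorComplex_isZero {X Y : CochainComplex (FiltVect k) ℤ}
    (hX : ∀ n, n ≠ 0 → IsZero (X.X n)) (hY : ∀ n, n ≠ 0 → IsZero (Y.X n)) (n : ℤ) (hn : n ≠ 0) :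
    IsZero ((tensorComplex X Y).X n) := by
  rw [IsZero.iff_id_eq_zero]
  apply mapBifunctor.hom_ext
  intro i j hij
  refine IsZero.eq_of_src ?_ _ _
  by_cases hi : i = 0
  · refine (FiltVect.tensor.obj (X.X i)).map_isZero (hY j fun hj => hn ?_)
    rw [← hij, hi, hj]
    rfl
  · exact (FiltVect.tensor.map_isZero (hX i hi)).obj _

open HomologicalComplex in
/-- The tensor product of two complexes concentrated in degree zero is, in degree zero, the tensor
product. -/
noncomputable def tensorComplexZeroIso {X Y : CochainComplex (FiltVect k) ℤ}
    (hX : ∀ n, n ≠ 0 → IsZero (X.X n)) (hY : ∀ n, n ≠ 0 → IsZero (Y.X n)) :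
    (tensorComplex X Y).X 0 ≅ (FiltVect.tensor.obj (X.X 0)).obj (Y.X 0) where
  hom := mapBifunctorDesc (K₁ := X) (K₂ := Y) (F := FiltVect.tensor) (c := ComplexShape.up ℤ)
    -- Every summand other than the one at `(0, 0)` is zero, so the value `0` is the only possible
    -- choice there.
    fun i j _ => if h : i = 0 ∧ j = 0 then
      eqToHom (by rw [h.1, h.2]) else 0
  inv := ιMapBifunctor X Y FiltVect.tensor (ComplexShape.up ℤ) 0 0 0 (by rfl)
  hom_inv_id := by
    apply mapBifunctor.hom_ext
    intro i j hij
    rw [ι_mapBifunctorDesc_assoc, Category.comp_id]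
    by_cases hi : i = 0
    · by_cases hj : j = 0
      · subst hi hj
        simp
      · exact ((FiltVect.tensor.obj (X.X i)).map_isZero (hY j hj)).eq_of_src _ _
    · exact ((FiltVect.tensor.map_isZero (hX i hi)).obj _).eq_of_src _ _
  inv_hom_id := by
    refine (ι_mapBifunctorDesc (K₁ := X) (K₂ := Y) (F := FiltVect.tensor)
      (c := ComplexShape.up ℤ) _ 0 0 _).trans ?_
    simp

namespace CochainComplex

/-- The complex is a line in degree zero, whose nonzero vectors have filtration `a`. -/
def IsLine (X : CochainComplex (FiltVect k) ℤ) (a : ℝ) : Prop :=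
  (∀ n, n ≠ 0 → IsZero (X.X n)) ∧ Nonempty (X.X 0 ≅ FiltVect.line k a)

variable {X Y : CochainComplex (FiltVect k) ℤ} {a b : ℝ}

lemma isLine_single (a : ℝ) : IsLine ((HomologicalComplex.single (FiltVect k)
    (ComplexShape.up ℤ) 0).obj (FiltVect.line k a)) a :=
  ⟨fun _ hn => HomologicalComplex.isZero_single_obj_X _ _ _ _ hn,
    ⟨HomologicalComplex.singleObjXSelf _ _ _⟩⟩

lemma IsLine.sigma (h : X.IsLine a) (r : ℝ) : IsLine ((sigma k r).obj X) (a + r) := by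
  obtain ⟨h, ⟨e⟩⟩ := h
  exact ⟨fun n hn => (FiltVect.shiftBy r).map_isZero (h n hn),
    ⟨(FiltVect.shiftBy r).mapIso e ≪≫ FiltVect.shiftByLine r a⟩⟩

lemma IsLine.tensor (hX : X.IsLine a) (hY : Y.IsLine b) :
    IsLine (tensorComplex X Y) (a + b) := by
  obtain ⟨hX, ⟨e⟩⟩ := hX
  obtain ⟨hY, ⟨e'⟩⟩ := hY
  exact ⟨tensorComplex_isZero hX hY, ⟨tensorComplexZeroIso hX hY ≪≫
    (FiltVect.tensor.mapIso e).app _ ≪≫ (FiltVect.tensor.obj _).mapIso e' ≪≫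
    FiltVect.tensorLine a b⟩⟩

lemma IsLine.isTame (h : X.IsLine a) : X.IsTame := by
  obtain ⟨h, ⟨e⟩⟩ := h
  have hg (n : ℤ) : (X.X n).Good := by
    by_cases hn : n = 0
    · subst hn
      exact FiltVect.Good.of_iso e (FiltVect.line_good a)
    · exact FiltVect.good_of_isZero (h n hn)
  refine ⟨fun s => (Set.finite_singleton 0).subset fun n hn => ?_,
    fun s n => (hg n).finiteDimensional s, ⟨a - 1, fun n => ?_⟩,
    fun n => (hg n).exhaustive, fun n => (hg n).right_continuous⟩
  · by_contra hne
    exact hn (FiltVect.level_eq_bot_of_isZero (h n hne) s)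
  · by_cases hn : n = 0
    · subst hn
      have := (hg 0).finiteDimensional (a - 1)
      rw [← Submodule.finrank_eq_zero (R := k), FiltVect.level_finrank_eq_of_iso e,
        FiltVect.line_level_of_lt (by linarith), finrank_bot]
    · exact FiltVect.level_eq_bot_of_isZero (h n hn) _

/-- As `s` varies, the Euler characteristic of a line is a step function with jump at `a`; this is
how lines of different filtrations are told apart in `K(C^t)`. -/
lemma IsLine.levelEuler_eq (h : X.IsLine a) (s : ℝ) [Decidable (a ≤ s)] :
    levelEuler s (ho X) = if a ≤ s then 1 else 0 := by
  obtain ⟨h, ⟨e⟩⟩ := h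
  rw [levelEuler_of_isZero s X h, FiltVect.level_finrank_eq_of_iso e, FiltVect.finrank_line_level]
  split_ifs <;> rfl

end CochainComplex

/-! ### Failure of multiplicativity -/

namespace GrothendieckGroup

lemma sub_mul_sub_tame (x y z w : GrothendieckGroup (tame k)) :
    (x - y) * (z - w) = x * z - x * w - (y * z - y * w) := by
  change tensorMul (tame k) tame_tensorComplex (x - y) (z - w) = tensorMul _ _ x z -
    tensorMul _ _ x w - (tensorMul _ _ y z - tensorMul _ _ y w)
  simp only [map_sub, AddMonoidHom.sub_apply]
  abel

/-- Both products come from the same tensor complex, so the comparison of `KA(C^t)` with `K(C^t)`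
respects them. -/
lemma ofLE_mk_mul_mk (X Y : CochainComplex (FiltVect k) ℤ)
    (hX : tameAcyclic k (ho X)) (hY : tameAcyclic k (ho Y)) :
    ofLE tameAcyclic_le_tame (mk (ho X) hX * mk (ho Y) hY) =
      ofLE tameAcyclic_le_tame (mk (ho X) hX) * ofLE tameAcyclic_le_tame (mk (ho Y) hY) := by
  rw [mk_mul_mk_acyclic, ofLE_mk, ofLE_mk, ofLE_mk, mk_mul_mk]

end GrothendieckGroup

/-- A supposed equality is pushed into `K(C^t)`, where it compares `1 - σ` with `(1 - σ)²`.
Injectivity of `KA ⟶ K` plays no role. -/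
lemma acyclicTruncation_mul_self_ne {r : ℝ} (hr : 0 < r) {X : CochainComplex (FiltVect k) ℤ}
    (h : X.IsLine 0) (hX : tame k (ho X)) :
    acyclicTruncation k r hr.le (GrothendieckGroup.mk (ho X) hX * GrothendieckGroup.mk (ho X) hX) ≠
      acyclicTruncation k r hr.le (GrothendieckGroup.mk (ho X) hX) *
        acyclicTruncation k r hr.le (GrothendieckGroup.mk (ho X) hX) := by
  classical
  intro heq
  have hσ := tame_sigma r X hX
  have hmul : GrothendieckGroup.ofLE tameAcyclic_le_tame
      (acyclicTruncation k r hr.le (GrothendieckGroup.mk (ho X) hX) *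
        acyclicTruncation k r hr.le (GrothendieckGroup.mk (ho X) hX)) =
      (GrothendieckGroup.mk (ho X) hX - GrothendieckGroup.mk _ hσ) *
        (GrothendieckGroup.mk (ho X) hX - GrothendieckGroup.mk _ hσ) := by
    rw [← ofLE_acyclicTruncation_mk r hr.le X hX, acyclicTruncation_mk,
      GrothendieckGroup.ofLE_mk_mul_mk]
  -- Level `r` sees the lines with filtration `0` and `r` but not `2r`. The two sides become `1 - 1
  -- = 0` and `(1 - 1) - (1 - 0) = -1`.
  have := congrArg (fun z => eulerHom k r (GrothendieckGroup.ofLE tameAcyclic_le_tame z)) heq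
  beta_reduce at this
  rw [hmul, GrothendieckGroup.mk_mul_mk, ofLE_acyclicTruncation_mk,
    GrothendieckGroup.sub_mul_sub_tame, GrothendieckGroup.mk_mul_mk, GrothendieckGroup.mk_mul_mk,
    GrothendieckGroup.mk_mul_mk, GrothendieckGroup.mk_mul_mk] at this
  simp only [map_sub, eulerHom_mk] at this
  rw [(h.tensor h).levelEuler_eq, ((h.tensor h).sigma r).levelEuler_eq,
    (h.tensor (h.sigma r)).levelEuler_eq, ((h.sigma r).tensor h).levelEuler_eq,
    ((h.sigma r).tensor (h.sigma r)).levelEuler_eq] at this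
  simp [hr.le, hr.not_ge] at this

end

theorem proposition4p12 {k : Type u} [Field k] (r : ℝ) (hr : 0 < r) :
    Function.Bijective (acyclicTruncation k r hr.le) ∧
      ¬ ∀ x y : GrothendieckGroup (tame k),
        acyclicTruncation k r hr.le (x * y) =
          acyclicTruncation k r hr.le x * acyclicTruncation k r hr.le y := by
  refine ⟨⟨acyclicTruncation_injective hr, acyclicTruncation_surjective hr⟩, fun h => ?_⟩
  have hl := CochainComplex.isLine_single (k := k) 0
  exact acyclicTruncation_mul_self_ne hr hl hl.isTame (h _ _)
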